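/- Let $d,m\in\mathbb{N}_0$, $T\in(0,\infty)$, $p\in[2,3)$ and $C_0\ge 0$. A $\frac1p$-Hölder rough path on $[0,T]$ is a pair $\mathbf{x}=(x,\mathbb{X})$ of a path $x\colon[0,T]\to\mathbb{R}^m$ and a map $\mathbb{X}\colon[0,T]^2\to\mathbb{R}^m\otimes\mathbb{R}^m$ such that, with $x_{s,t}:=x(t)-x(s)$, one has $\mathbb{X}_{s,t}-\mathbb{X}_{s,u}-\mathbb{X}_{u,t}=x_{s,u}\otimes x_{u,t}$ for all $s,u,t\in[0,T]$ and $$\|\mathbf{x}\|_{1/p;[0,T]}:=\sup_{0\le s<t\le T}\frac{|x_{s,t}|}{|t-s|^{1/p}}+\Big(\sup_{0\le s<t\le T}\frac{|\mathbb{X}_{s,t}|}{|t-s|^{2/p}}\Big)^{1/2}<\infty .$$ Let $b\colon\mathbb{R}^d\to\mathbb{R}^d$ be bounded and Lipschitz continuous, and let $\sigma\colon\mathbb{R}^d\to L(\mathbb{R}^m,\mathbb{R}^d)$ be of class $\mathcal{C}^3_b$, i.e. three times Fréchet differentiable with $\sigma, D\sigma, D^2\sigma, D^3\sigma$ bounded.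 For $s\in[0,T]$ and $\xi\in\mathbb{R}^d$, a solution on $[s,T]$ of $$dy=b(y)\,dt+\sigma(y)\,d\mathbf{x},\qquad y(s)=\xi, \tag{1}$$ is a pair $(y,y')$ of paths $y\colon[s,T]\to\mathbb{R}^d$, $y'\colon[s,T]\to L(\mathbb{R}^m,\mathbb{R}^d)$ that is controlled by $x$ (that is, $y'$ is $\frac1p$-Hölder and $\sup_{s\le u<v\le T}|y(v)-y(u)-y'(u)x_{u,v}|/|v-u|^{2/p}<\infty$) and satisfies $$y(t)=\xi+\int_s^t b(y(r))\,dr+\int_s^t\sigma(y(r))\,d\mathbf{x}(r)\qquad\text{for all }t\in[s,T],$$ where the last term is a rough integral, i.e. the limit, as the mesh of the partition $(t_i)$ of $[s,t]$ tends to $0$, of $\sum_i \sigma(y(t_i))x_{t_i,t_{i+1}}+D\sigma(y(t_i))y'(t_i)\,\mathbb{X}_{t_i,t_{i+1}}$. There are constants $\delta>0$ and $L>0$, depending only on $p$, $C_0$, $T$, $b$ and $\sigma$, such that for every $\frac1p$-Hölder rough path $\mathbf{x}$ with $\|\mathbf{x}\|_{1/p;[0,T]}\le C_0$ the following holds. 1.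 For all $s\in[0,T]$ and $\xi\in\mathbb{R}^d$ (in particular for $s=0$), equation (1) has exactly one solution $(y,y')$ on $[s,T]$ in the space of controlled paths with $y'(t)=\sigma(y(t))$ for all $t\in[s,T]$. 2. Equation (1) induces a continuous flow: there is a map $\phi\colon[0,T]\times[0,T]\times\mathbb{R}^d\to\mathbb{R}^d$, jointly continuous, with $\phi(t,t,\zeta)=\zeta$ and $\phi(u,t,\phi(s,u,\zeta))=\phi(s,t,\zeta)$ for all $s,u,t\in[0,T]$ (in any order) and $\zeta\in\mathbb{R}^d$, such that for all $s\in[0,T]$ and $\zeta\in\mathbb{R}^d$ the path $y=\phi(s,\cdot,\zeta)$ on $[s,T]$, with $y'=\sigma(y)$, is the solution of (1) with $y(s)=\zeta$. Moreover $$|\phi(s,t,\zeta_1)-\phi(s,t,\zeta_2)|\le\big(1+L|t-s|^{1/p}\big)|\zeta_1-\zeta_2|$$ for all $s<t$ in $[0,T]$ with $|t-s|\le\delta$ and all $\zeta_1,\zeta_2\in\mathbb{R}^d$. -/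

import Mathlib

open Set Filter Topology MeasureTheory
open scoped ENNReal NNReal TensorProduct

namespace RoughPaths

section Definitions

variable {E : Type*} [NormedAddCommGroup E] [InnerProductSpace ℝ E]
variable {V : Type*} [NormedAddCommGroup V] [NormedSpace ℝ V]
variable {W : Type*} [NormedAddCommGroup W] [NormedSpace ℝ W]

/-- The increment `x_{s,t} = x(t) - x(s)` of a path. -/
def incr (x : ℝ → V) (s t : ℝ) : V := x t - x s

/-- The Hölder seminorm `sup_{a ≤ s < t ≤ b} |F_{s,t}| / |t - s|^α`, with values in `[0, ∞]`, of a
two-parameter function `F`. The Hölder seminorm of a path `x` is that of `incr x`. -/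
noncomputable def holderSeminorm (α a b : ℝ) (F : ℝ → ℝ → V) : ℝ≥0∞ :=
  ⨆ s ∈ Icc a b, ⨆ t ∈ Icc a b, ⨆ _ : s < t, ENNReal.ofReal (‖F s t‖ / |t - s| ^ α)

/-- The homogeneous rough path norm
`‖(x, 𝕏)‖_{1/p;[0,T]} = ‖x‖_{1/p;[0,T]} + √‖𝕏‖_{2/p;[0,T]}`, with values in `[0, ∞]`.
The tensor product carries the norm with `‖v ⊗ w‖ = ‖v‖ ‖w‖` given by its inner product. -/
noncomputable def roughNorm (p T : ℝ) (x : ℝ → E) (X : ℝ → ℝ → E ⊗[ℝ] E) : ℝ≥0∞ :=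
  holderSeminorm (1 / p) 0 T (incr x) + (holderSeminorm (2 / p) 0 T X) ^ (1 / 2 : ℝ)

/-- `(x, 𝕏)` is a `1/p`-Hölder rough path on `[0, T]`: Chen's relation and finiteness of the norm.
Values outside `[0, T]` are irrelevant. -/
structure IsRoughPath (p T : ℝ) (x : ℝ → E) (X : ℝ → ℝ → E ⊗[ℝ] E) : Prop where
  chen : ∀ s ∈ Icc 0 T, ∀ u ∈ Icc 0 T, ∀ t ∈ Icc 0 T,
    X s t - X s u - X u t = incr x s u ⊗ₜ[ℝ] incr x u t
  finite : roughNorm p T x X < ∞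

/-- `(y, y')` is a path controlled by `x` on `[a, b]`: the Gubinelli derivative `y'` is
`1/p`-Hölder and the remainder `R_{s,t} = y_{s,t} - y'(s) x_{s,t}` is `2/p`-Hölder. -/
structure IsControlled (p a b : ℝ) (x : ℝ → E) (y : ℝ → W) (y' : ℝ → E →L[ℝ] W) : Prop where
  deriv_holder : holderSeminorm (1 / p) a b (incr y') < ∞
  remainder_holder :
    holderSeminorm (2 / p) a b (fun s t => incr y s t - y' s (incr x s t)) < ∞

/-- A bilinear map applied to a tensor: the linear map with `A (v ⊗ w) = A v w`. -/
noncomputable def applyTensor (A : E →L[ℝ] E →L[ℝ] W) : E ⊗[ℝ] E →ₗ[ℝ] W :=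
  TensorProduct.lift A.toLinearMap₁₂

/-- `I` is the rough integral `∫_a^b Y d𝐱` of the integrand `(Y, Y')`: the limit of the compensated
Riemann sums `∑ Y(t_i) x_{t_i,t_{i+1}} + Y'(t_i) 𝕏_{t_i,t_{i+1}}` over the partitions
`a = t_0 ≤ ⋯ ≤ t_n = b` as the mesh tends to zero. -/
def HasRoughIntegral (x : ℝ → E) (X : ℝ → ℝ → E ⊗[ℝ] E)
    (Y : ℝ → E →L[ℝ] W) (Y' : ℝ → E →L[ℝ] E →L[ℝ] W) (a b : ℝ) (I : W) : Prop :=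
  ∀ ε > 0, ∃ η > 0, ∀ (n : ℕ) (τ : ℕ → ℝ), Monotone τ → τ 0 = a → τ n = b →
    (∀ i < n, τ (i + 1) - τ i < η) →
    ‖∑ i ∈ Finset.range n, (Y (τ i) (incr x (τ i) (τ (i + 1)))
        + applyTensor (Y' (τ i)) (X (τ i) (τ (i + 1)))) - I‖ < ε

/-- The controlled path `(y, y')` solves `dy = b(y) dt + σ(y) d𝐱` on `[s, T]` with `y(s) = ξ`:
for every `t ∈ [s, T]`, `y(t) = ξ + ∫_s^t b(y(r)) dr + ∫_s^t σ(y(r)) d𝐱(r)`, the last integral being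
the rough integral of `σ(y)` with Gubinelli derivative `Dσ(y) y'`. -/
structure IsRDESolution (p T : ℝ) (x : ℝ → E) (X : ℝ → ℝ → E ⊗[ℝ] E)
    (b : W → W) (σ : W → E →L[ℝ] W) (s : ℝ) (ξ : W)
    (y : ℝ → W) (y' : ℝ → E →L[ℝ] W) : Prop where
  controlled : IsControlled p s T x y y'
  equation : ∀ t ∈ Icc s T,
    HasRoughIntegral x X (fun r => σ (y r)) (fun r => (fderiv ℝ σ (y r)).comp (y' r)) s t
      (y t - ξ - ∫ r in s..t, b (y r))

/-- The class `C^k_b`: `k` times Fréchet differentiable, the function and all its derivatives up to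
order `k` being bounded. -/
def IsCkb (k : ℕ) (σ : V → W) : Prop :=
  (∀ i < k, Differentiable ℝ (iteratedFDeriv ℝ i σ)) ∧
    ∀ i ≤ k, ∃ M : ℝ, ∀ z, ‖iteratedFDeriv ℝ i σ z‖ ≤ M

end Definitions

/-- A continuous flow on the space `S` with times in `I`. All times are allowed, in any order,
so `φ t s` is the inverse of `φ s t`. -/
structure IsContinuousFlow {S : Type*} [TopologicalSpace S] (I : Set ℝ)
    (φ : ℝ → ℝ → S → S) : Prop where
  refl : ∀ t ∈ I, ∀ ζ, φ t t ζ = ζ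
  comp : ∀ s ∈ I, ∀ u ∈ I, ∀ t ∈ I, ∀ ζ, φ u t (φ s u ζ) = φ s t ζ
  continuous : ContinuousOn (fun q : ℝ × ℝ × S => φ q.1 q.2.1 q.2.2) (I ×ˢ I ×ˢ univ)

end RoughPaths

/-! The proof follows Davie's approach. Put `α = 1/p`, so that `1/3 < α ≤ 1/2`, and let `V s t ξ =
σ(ξ) x_{s,t} + Dσ(ξ)σ(ξ) 𝕏_{s,t}` and `μ s t ξ = ξ + (t - s) b(ξ) + V s t ξ`. By Chen's relation the
second-order terms cancel when two steps are composed, so `μ` is a flow up to an error of order `|t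
- s|^(3α)`. Since `3α > 1`, such errors can be summed over partitions. A Davie solution is a path
with `|y t - μ s t (y s)| ≤ M |t - s|^(3α)` for all pairs of times in either order. The two-sided
formulation makes the maps of the flow invertible.

Existence (`exists_davie`): Euler paths on uniform grids obey the Davie estimate with a constant
independent of the mesh, by `discrete_sewing`. A limit along an ultrafilter gives a solution on a
short interval, and short solutions are glued.

Stability (`exists_local_lipschitz`): for two solutions `y`, `z`, compare the step errors `y t - y s
- ∫ b(y) - V s t (y s)`. Bisecting the interval improves any bound on their difference by a factor
below one, up to a multiple of `sup |y - z|` (`stepError_sub_le`). The drift enters through its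
exact integral because `b` is only Lipschitz: the integral is additive in time, so no second-order
differences of `b` occur. On short intervals `sup |y - z|` is absorbed, which gives the constant `1
+ L |t - s|^α`. Chaining gives a global Lipschitz constant, hence uniqueness, the flow property and
joint continuity (`exists_davie_flow`).

Equivalence: for a Davie solution the compensated Riemann sums telescope up to step errors, whose
sum vanishes with the mesh. Conversely, for a controlled solution with `y' = σ(y)` the germ `V s t
(y s)` is almost additive, so sewing bounds the rough integral minus the germ and gives the Davie
estimate. All constants depend on the rough path only through its norm bound. -/

namespace RoughPaths

/-! ### The Hölder modulus `|t - s| ^ α` -/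

/-- The modulus `|t - s| ^ α` of a time interval. -/
noncomputable def modulus (α s t : ℝ) : ℝ := |t - s| ^ α

/-- The factor by which bisection of the interval decreases the sum of the cubed moduli. -/
noncomputable def bisectFactor (α : ℝ) : ℝ := 2 * ((1 / 2 : ℝ) ^ α) ^ 3

lemma modulus_nonneg (α s t : ℝ) : 0 ≤ modulus α s t := Real.rpow_nonneg (abs_nonneg _) _

lemma modulus_self {α : ℝ} (hα : 0 < α) (s : ℝ) : modulus α s s = 0 := by
  simp [modulus, Real.zero_rpow hα.ne']

lemma modulus_comm (α s t : ℝ) : modulus α s t = modulus α t s := by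
  simp [modulus, abs_sub_comm]

lemma modulus_mono {α : ℝ} (hα : 0 < α) {s t s' t' : ℝ} (h : |t - s| ≤ |t' - s'|) :
    modulus α s t ≤ modulus α s' t' := Real.rpow_le_rpow (abs_nonneg _) h hα.le

lemma modulus_le {α : ℝ} (hα : 0 < α) {s t h : ℝ} (hst : |t - s| ≤ h) :
    modulus α s t ≤ h ^ α := Real.rpow_le_rpow (abs_nonneg _) hst hα.le

lemma modulus_pow_eq (α : ℝ) (n : ℕ) (s t : ℝ) : modulus α s t ^ n = |t - s| ^ (n * α) := by
  rw [modulus, ← Real.rpow_natCast, ← Real.rpow_mul (abs_nonneg _), mul_comm]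

lemma tendsto_modulus {α : ℝ} (hα : 0 < α) (t : ℝ) :
    Tendsto (fun s => modulus α s t) (𝓝 t) (𝓝 0) := by
  have : Continuous fun s => modulus α s t :=
    (continuous_const.sub continuous_id).abs.rpow_const fun _ => Or.inr hα.le
  simpa [modulus_self hα] using this.tendsto t

lemma bisectFactor_nonneg (α : ℝ) : 0 ≤ bisectFactor α := by unfold bisectFactor; positivity

/-- The factor equals `2^(1 - 3α)`; with `α = 1/p` it is below one exactly when `p < 3`. -/
lemma bisectFactor_lt_one {α : ℝ} (hα : 1 / 3 < α) : bisectFactor α < 1 := by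
  have h : ((1 / 2 : ℝ) ^ α) ^ 3 < 1 / 2 := by
    rw [← Real.rpow_natCast, ← Real.rpow_mul (by norm_num)]
    calc (1 / 2 : ℝ) ^ (α * (3 : ℕ)) < (1 / 2 : ℝ) ^ (1 : ℝ) :=
          Real.rpow_lt_rpow_of_exponent_gt (by norm_num) (by norm_num) (by push_cast; linarith)
      _ = 1 / 2 := by simp
  unfold bisectFactor; linarith

/-- Each half carries `bisectFactor α / 2`, so the two halves together carry the contraction factor
`bisectFactor α`. -/
lemma modulus_midpoint_left (α s t : ℝ) :
    modulus α s ((s + t) / 2) ^ 3 = bisectFactor α / 2 * modulus α s t ^ 3 := by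
  have : |(s + t) / 2 - s| = 1 / 2 * |t - s| := by
    rw [show (s + t) / 2 - s = 1 / 2 * (t - s) by ring, abs_mul]; norm_num
  rw [modulus, this, Real.mul_rpow (by norm_num) (abs_nonneg _), bisectFactor, modulus]; ring

lemma modulus_midpoint_right (α s t : ℝ) :
    modulus α ((s + t) / 2) t ^ 3 = bisectFactor α / 2 * modulus α s t ^ 3 := by
  rw [modulus_comm, add_comm, modulus_midpoint_left, modulus_comm]

lemma modulus_midpoint_le {α : ℝ} (hα : 0 < α) (s t : ℝ) :
    modulus α s ((s + t) / 2) ≤ modulus α s t ∧ modulus α ((s + t) / 2) t ≤ modulus α s t := by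
  constructor <;> apply modulus_mono hα
  · rw [show (s + t) / 2 - s = (t - s) / 2 by ring, abs_div, abs_two]
    linarith [abs_nonneg (t - s)]
  · rw [show t - (s + t) / 2 = (t - s) / 2 by ring, abs_div, abs_two]
    linarith [abs_nonneg (t - s)]

lemma midpoint_mem_Icc {a b s t : ℝ} (hs : s ∈ Icc a b) (ht : t ∈ Icc a b) :
    (s + t) / 2 ∈ Icc a b := ⟨by linarith [hs.1, ht.1], by linarith [hs.2, ht.2]⟩

lemma abs_sub_le_of_mem_Icc {a b s t : ℝ} (hs : s ∈ Icc a b) (ht : t ∈ Icc a b) :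
    |t - s| ≤ b - a := abs_le.2 ⟨by linarith [hs.2, ht.1], by linarith [hs.1, ht.2]⟩

/-- A positive `δ` with `K * δ ^ α ≤ ε`. -/
lemma exists_rpow_small {α : ℝ} (hα : 0 < α) (K : ℝ) {ε : ℝ} (hε : 0 < ε) :
    ∃ δ > 0, K * δ ^ α ≤ ε := by
  have : Tendsto (fun h : ℝ => K * h ^ α) (𝓝[>] 0) (𝓝 0) := by
    have h : Continuous fun h : ℝ => K * h ^ α :=
      continuous_const.mul (continuous_id.rpow_const fun _ => Or.inr hα.le)
    have := h.tendsto 0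
    simp only [Real.zero_rpow hα.ne', mul_zero] at this
    exact this.mono_left nhdsWithin_le_nhds
  obtain ⟨δ, h1, h2⟩ := ((this.eventually (gt_mem_nhds hε)).and self_mem_nhdsWithin).exists
  exact ⟨δ, h2, h1.le⟩

/-! ### Self-improving bounds and discrete sewing -/

/-- A bound that can be improved by a contraction holds with the fixed point of the contraction. -/
lemma bound_of_self_improving {S : Set ℝ} {f g : ℝ → ℝ → ℝ} {q c N₀ : ℝ} (hq₀ : 0 ≤ q)
    (hq₁ : q < 1) (hc : 0 ≤ c) (hN₀ : 0 ≤ N₀) (h₀ : ∀ s ∈ S, ∀ t ∈ S, f s t ≤ N₀ * g s t)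
    (step : ∀ N, 0 ≤ N → (∀ s ∈ S, ∀ t ∈ S, f s t ≤ N * g s t) →
      ∀ s ∈ S, ∀ t ∈ S, f s t ≤ (q * N + c) * g s t) :
    ∀ s ∈ S, ∀ t ∈ S, f s t ≤ c / (1 - q) * g s t := by
  have hq : 0 < 1 - q := by linarith
  -- The improvement is iterated from the finite bound `N₀`. The contribution of `N₀` decays like `q
  -- ^ n`, so only its finiteness matters.
  let u : ℕ → ℝ := fun n => (fun N => q * N + c)^[n] N₀
  have hu : ∀ n, 0 ≤ u n ∧ ∀ s ∈ S, ∀ t ∈ S, f s t ≤ u n * g s t := by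
    intro n
    induction n with
    | zero => exact ⟨hN₀, h₀⟩
    | succ n ih =>
      have : u (n + 1) = q * u n + c := Function.iterate_succ_apply' _ _ _
      rw [this]
      exact ⟨by have := ih.1; positivity, step _ ih.1 ih.2⟩
  have hu' : ∀ n, u n = c / (1 - q) + q ^ n * (N₀ - c / (1 - q)) := by
    intro n
    induction n with
    | zero => simp [u]
    | succ n ih =>
      have : u (n + 1) = q * u n + c := Function.iterate_succ_apply' _ _ _
      rw [this, ih]; field_simp; ring
  have hlim : Tendsto u atTop (𝓝 (c / (1 - q))) := by
    have := ((tendsto_pow_atTop_nhds_zero_of_lt_one hq₀ hq₁).mul_const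
      (N₀ - c / (1 - q))).const_add (c / (1 - q))
    simp only [zero_mul, add_zero] at this
    exact this.congr fun n => (hu' n).symm
  intro s hs t ht
  exact ge_of_tendsto (hlim.mul_const _) (Eventually.of_forall fun n => (hu n).2 s hs t ht)

/-- Discrete sewing: a function of pairs of indices that vanishes on neighbours and is almost
subadditive with an error of order `θ > 1` is itself of order `θ`. -/
lemma discrete_sewing {κ ρ c h α : ℝ} (hh : 0 ≤ h) (hα : 1 / 3 < α) (hρ : 0 ≤ ρ) (hc : 0 ≤ c)
    (hκ : κ = (1 + ρ) * (2 / 3 : ℝ) ^ (3 * α - 1)) (hκ₁ : κ < 1) {a : ℕ → ℕ → ℝ} {n : ℕ}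
    (h_self : ∀ i ≤ n, a i i ≤ 0) (h_next : ∀ i < n, a i (i + 1) ≤ 0)
    (h_add : ∀ i j k, i ≤ j → j ≤ k → k ≤ n →
      a i k ≤ (1 + ρ) * a i j + a j k + c * ((k - i : ℕ) * h) ^ (3 * α)) :
    ∀ i k, i ≤ k → k ≤ n → a i k ≤ c / (1 - κ) * ((k - i : ℕ) * h) ^ (3 * α) := by
  have hκ' : 0 < 1 - κ := by linarith
  set θ := 3 * α with hθ
  have hθ1 : 0 < θ - 1 := by linarith
  suffices H : ∀ l i k : ℕ, k = i + l → k ≤ n → a i k ≤ c / (1 - κ) * (l * h) ^ θ by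
    intro i k hik hkn
    exact H (k - i) i k (by omega) hkn
  intro l
  induction l using Nat.strong_induction_on with
  | _ l ih =>
    intro i k hk hkn
    rcases Nat.lt_or_ge l 2 with hl | hl
    · have : 0 ≤ c / (1 - κ) * (l * h) ^ θ := by positivity
      interval_cases l
      · rw [show k = i by omega]
        exact (h_self i (by omega)).trans this
      · rw [show k = i + 1 by omega]
        exact (h_next i (by omega)).trans this
    -- For `l ≥ 2` both halves have length at most `2l/3`, with equality for the longer half at `l =
    -- 3`; hence the number `2/3`.
    · set j := l / 2 with hj
      have hj1 : j < l := by omega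
      have hj2 : l - j < l := by omega
      have h1 := ih j hj1 i (i + j) rfl (by omega)
      have h2 := ih (l - j) hj2 (i + j) k (by omega) hkn
      have h3 := h_add i (i + j) k (by omega) (by omega) hkn
      have hki : k - i = l := by omega
      rw [hki] at h3
      -- One power of `m / l` is kept, since these fractions add up to one over the two halves. The
      -- remaining `θ - 1` powers supply the contraction.
      have key : ∀ m : ℕ, 3 * m ≤ 2 * l →
          ((m : ℝ) * h) ^ θ ≤ (2 / 3 : ℝ) ^ (θ - 1) * ((m : ℝ) / l) * ((l : ℝ) * h) ^ θ := by
        intro m hm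
        have hl0 : (0 : ℝ) < l := by exact_mod_cast (by omega : 0 < l)
        have hml : (m : ℝ) / l ≤ 2 / 3 := by
          rw [div_le_div_iff₀ hl0 (by norm_num)]
          have : (3 * m : ℝ) ≤ 2 * l := by exact_mod_cast hm
          linarith
        have e : (m : ℝ) * h = (m / l) * (l * h) := by field_simp
        rw [e, Real.mul_rpow (by positivity) (by positivity)]
        gcongr
        rcases Nat.eq_zero_or_pos m with rfl | hm0
        · simp [Real.zero_rpow (by linarith : θ ≠ 0)]
        · have hpos : (0 : ℝ) < m / l := by have : (0 : ℝ) < m := by exact_mod_cast hm0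
                                            positivity
          calc ((m : ℝ) / l) ^ θ = (m / l) ^ (θ - 1) * (m / l) := by
                rw [← Real.rpow_add_one hpos.ne']; congr 1; ring
            _ ≤ _ := by gcongr
      have k1 := key j (by omega)
      have k2 := key (l - j) (by omega)
      have hM : 0 ≤ c / (1 - κ) := by positivity
      have hsum : (j : ℝ) / l + ((l - j : ℕ) : ℝ) / l = 1 := by
        rw [Nat.cast_sub hj1.le]
        have hl0 : (0 : ℝ) < l := by exact_mod_cast (by omega : 0 < l)
        field_simp; ring
      have h23 : 0 ≤ (2 / 3 : ℝ) ^ (θ - 1) := by positivity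
      have hLh : 0 ≤ ((l : ℝ) * h) ^ θ := by positivity
      calc a i k ≤ (1 + ρ) * (c / (1 - κ) * (j * h) ^ θ)
            + c / (1 - κ) * (((l - j : ℕ) : ℝ) * h) ^ θ + c * (l * h) ^ θ := by
            have : (1 + ρ) * a i (i + j) ≤ (1 + ρ) * (c / (1 - κ) * (j * h) ^ θ) := by gcongr
            linarith
        -- The second half is also given the factor `1 + ρ`, so that the fractions can be
        -- recombined. The constant `c / (1 - κ)` is the fixed point of `M ↦ κ M + c`.
        _ ≤ (1 + ρ) * (c / (1 - κ) * (j * h) ^ θ)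
            + (1 + ρ) * (c / (1 - κ) * (((l - j : ℕ) : ℝ) * h) ^ θ) + c * (l * h) ^ θ := by
            have : 0 ≤ c / (1 - κ) * (((l - j : ℕ) : ℝ) * h) ^ θ := by positivity
            nlinarith
        _ ≤ (1 + ρ) * (c / (1 - κ) * ((2 / 3 : ℝ) ^ (θ - 1) * ((j : ℝ) / l) * ((l : ℝ) * h) ^ θ))
            + (1 + ρ) * (c / (1 - κ) *
              ((2 / 3 : ℝ) ^ (θ - 1) * (((l - j : ℕ) : ℝ) / l) * ((l : ℝ) * h) ^ θ))
            + c * (l * h) ^ θ := by gcongr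
        _ = c / (1 - κ) * (κ * ((j : ℝ) / l + ((l - j : ℕ) : ℝ) / l) + (1 - κ)) * (l * h) ^ θ := by
            field_simp; rw [hκ]
        _ = c / (1 - κ) * (l * h) ^ θ := by rw [hsum]; ring

/-! ### Almost flows and their Davie solutions -/

section AlmostFlow

variable {W : Type*} [NormedAddCommGroup W]

/-- A family of maps `μ s t` that are close to the identity and form a flow up to errors of
order `|t - s| ^ (3 α)`. The times may be in any order. -/
structure IsAlmostFlow (α T C : ℝ) (μ : ℝ → ℝ → W → W) : Prop where
  nonneg : 0 ≤ C
  dist_id : ∀ s ∈ Icc 0 T, ∀ t ∈ Icc 0 T, ∀ ξ, ‖μ s t ξ - ξ‖ ≤ C * modulus α s t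
  lip : ∀ s ∈ Icc 0 T, ∀ t ∈ Icc 0 T, ∀ ξ ζ,
    ‖μ s t ξ - μ s t ζ‖ ≤ (1 + C * modulus α s t) * ‖ξ - ζ‖
  defect : ∀ s ∈ Icc 0 T, ∀ u ∈ Icc 0 T, ∀ t ∈ Icc 0 T, ∀ r, modulus α s u ≤ r →
    modulus α u t ≤ r → ∀ ξ, ‖μ u t (μ s u ξ) - μ s t ξ‖ ≤ C * r ^ 3
  cont : ∀ ξ, ContinuousOn (fun q : ℝ × ℝ => μ q.1 q.2 ξ) (Icc 0 T ×ˢ Icc 0 T)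

/-- The Davie estimate: on `S` the path `y` follows `μ` up to `M |t - s| ^ (3 α)`. -/
def DavieBound (α : ℝ) (μ : ℝ → ℝ → W → W) (S : Set ℝ) (M : ℝ) (y : ℝ → W) : Prop :=
  ∀ s ∈ S, ∀ t ∈ S, ‖y t - μ s t (y s)‖ ≤ M * modulus α s t ^ 3

lemma DavieBound.mono {α M M' : ℝ} {μ : ℝ → ℝ → W → W} {S S' : Set ℝ} {y : ℝ → W}
    (h : DavieBound α μ S M y) (hS : S' ⊆ S) (hM : M ≤ M') : DavieBound α μ S' M' y := by
  intro s hs t ht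
  have := pow_nonneg (modulus_nonneg α s t) 3
  exact (h s (hS hs) t (hS ht)).trans (by gcongr)

namespace IsAlmostFlow

variable {α T C : ℝ} {μ : ℝ → ℝ → W → W}

lemma apply_self (h : IsAlmostFlow α T C μ) (hα : 0 < α) {s : ℝ} (hs : s ∈ Icc 0 T) (ξ : W) :
    μ s s ξ = ξ := by
  have := h.dist_id s hs s hs ξ
  rw [modulus_self hα, mul_zero] at this
  exact sub_eq_zero.1 (norm_le_zero_iff.1 this)

/-- A Davie estimate in one time direction gives one in the other direction. -/
lemma reverse (h : IsAlmostFlow α T C μ) (hα : 0 < α) {s t : ℝ} (hs : s ∈ Icc 0 T)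
    (ht : t ∈ Icc 0 T) {η ξ : W} {M : ℝ} (hM : ‖η - μ s t ξ‖ ≤ M * modulus α s t ^ 3) :
    ‖ξ - μ t s η‖ ≤ (C + (1 + C * T ^ α) * M) * modulus α t s ^ 3 := by
  -- A step forth and back: the middle time lies outside the degenerate interval from `s` to `s`.
  -- For this reason the defect is measured by a bound on both moduli and not by the modulus of the
  -- end points.
  have h1 := h.defect s hs t ht s hs _ le_rfl (modulus_comm α t s).le ξ
  rw [h.apply_self hα hs] at h1
  have h2 := h.lip t ht s hs (μ s t ξ) η
  have h3 : modulus α t s ≤ T ^ α := modulus_le hα (by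
    simpa using abs_sub_le_of_mem_Icc ht hs)
  rw [modulus_comm α t s] at h2 h3 ⊢
  have hC := h.nonneg
  calc ‖ξ - μ t s η‖ = ‖(μ t s (μ s t ξ) - μ t s η) - (μ t s (μ s t ξ) - ξ)‖ := by congr 1; abel
    _ ≤ ‖μ t s (μ s t ξ) - μ t s η‖ + ‖μ t s (μ s t ξ) - ξ‖ := norm_sub_le _ _
    _ ≤ (1 + C * T ^ α) * (M * modulus α s t ^ 3) + C * modulus α s t ^ 3 := by
        refine add_le_add (h2.trans ?_) h1
        rw [norm_sub_rev]
        have := modulus_nonneg α s t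
        have : 0 ≤ T ^ α := this.trans h3
        gcongr
    _ = _ := by ring

/-- Triangle inequality for Davie estimates. -/
lemma compose (h : IsAlmostFlow α T C μ) {s u t : ℝ} (hs : s ∈ Icc 0 T)
    (hu : u ∈ Icc 0 T) (ht : t ∈ Icc 0 T) {r : ℝ} (hsu : modulus α s u ≤ r)
    (hut : modulus α u t ≤ r) (ξ η ζ : W) :
    ‖ζ - μ s t ξ‖ ≤ (1 + C * modulus α u t) * ‖η - μ s u ξ‖ + ‖ζ - μ u t η‖ + C * r ^ 3 := by
  calc ‖ζ - μ s t ξ‖ = ‖(ζ - μ u t η) + (μ u t η - μ u t (μ s u ξ))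
        + (μ u t (μ s u ξ) - μ s t ξ)‖ := by congr 1; abel
    _ ≤ ‖ζ - μ u t η‖ + ‖μ u t η - μ u t (μ s u ξ)‖ + ‖μ u t (μ s u ξ) - μ s t ξ‖ := norm_add₃_le
    _ ≤ _ := by
      have := h.lip u hu t ht η (μ s u ξ)
      have := h.defect s hs u hu t ht r hsu hut ξ
      linarith

/-- Solutions on adjacent intervals that agree at the common point can be glued. -/
lemma glue (h : IsAlmostFlow α T C μ) (hα : 0 < α) {a c b : ℝ} (ha : 0 ≤ a) (hac : a ≤ c)
    (hcb : c ≤ b) (hb : b ≤ T) {y z : ℝ → W} (hy : ∃ M, DavieBound α μ (Icc a c) M y)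
    (hz : ∃ M, DavieBound α μ (Icc c b) M z) (hc : y c = z c) :
    ∃ M, DavieBound α μ (Icc a b) M (fun t => if t ≤ c then y t else z t) := by
  obtain ⟨M, hM⟩ := hy
  obtain ⟨N, hN⟩ := hz
  set w : ℝ → W := fun t => if t ≤ c then y t else z t with hw
  have hwy : ∀ t ≤ c, w t = y t := fun t ht => by simp [hw, ht]
  have hwz : ∀ t, c ≤ t → w t = z t := fun t ht => by
    rcases ht.eq_or_lt with rfl | ht
    · simp [hw, hc]
    · simp [hw, not_le.2 ht]
  have hC := h.nonneg
  have hT : 0 ≤ T := by linarith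
  have hTα : 0 ≤ T ^ α := Real.rpow_nonneg hT α
  set Q := (1 + C * T ^ α) * |M| + |N| + C with hQ
  have hQ0 : 0 ≤ Q := by positivity
  -- Only pairs of times on different sides of `c` need work: forward pairs pass through `c`,
  -- backward pairs then follow by `reverse`.
  have across : ∀ s ∈ Icc a c, ∀ t ∈ Icc c b, ‖w t - μ s t (w s)‖ ≤ Q * modulus α s t ^ 3 := by
    intro s hs t ht
    have hs' : s ∈ Icc 0 T := ⟨by linarith [hs.1], by linarith [hs.2]⟩
    have ht' : t ∈ Icc 0 T := ⟨by linarith [ht.1], by linarith [ht.2]⟩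
    have hc' : c ∈ Icc 0 T := ⟨by linarith, by linarith⟩
    have m1 : modulus α s c ≤ modulus α s t := modulus_mono hα (by
      rw [abs_of_nonneg (by linarith [hs.2]), abs_of_nonneg (by linarith [hs.2, ht.1])]
      linarith [ht.1])
    have m2 : modulus α c t ≤ modulus α s t := modulus_mono hα (by
      rw [abs_of_nonneg (by linarith [ht.1]), abs_of_nonneg (by linarith [hs.2, ht.1])]
      linarith [hs.2])
    have m3 : modulus α c t ≤ T ^ α := modulus_le hα (by
      simpa using abs_sub_le_of_mem_Icc hc' ht')
    have e := h.compose hs' hc' ht' m1 m2 (w s) (w c) (w t)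
    have e1 : ‖w c - μ s c (w s)‖ ≤ |M| * modulus α s t ^ 3 := by
      rw [hwy c le_rfl, hwy s hs.2]
      refine (hM s hs c ⟨hac, le_rfl⟩).trans ?_
      have := modulus_nonneg α s c
      gcongr
      exact le_abs_self M
    have e2 : ‖w t - μ c t (w c)‖ ≤ |N| * modulus α s t ^ 3 := by
      rw [hwz c le_rfl, hwz t ht.1]
      refine (hN c ⟨le_rfl, hcb⟩ t ht).trans ?_
      have := modulus_nonneg α c t
      gcongr
      exact le_abs_self N
    calc _ ≤ _ := e
      _ ≤ (1 + C * T ^ α) * (|M| * modulus α s t ^ 3) + |N| * modulus α s t ^ 3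
          + C * modulus α s t ^ 3 := by gcongr
      _ = _ := by rw [hQ]; ring
  -- The sum dominates the constants of all four cases: within either piece, across `c` forwards and
  -- across `c` backwards.
  refine ⟨|M| + |N| + Q + (C + (1 + C * T ^ α) * Q), ?_⟩
  have hQ' : 0 ≤ C + (1 + C * T ^ α) * Q := by positivity
  intro s hs t ht
  have hs' : s ∈ Icc 0 T := ⟨by linarith [hs.1], by linarith [hs.2]⟩
  have ht' : t ∈ Icc 0 T := ⟨by linarith [ht.1], by linarith [ht.2]⟩
  have fin : ∀ K, K ≤ |M| + |N| + Q + (C + (1 + C * T ^ α) * Q) →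
      ‖w t - μ s t (w s)‖ ≤ K * modulus α s t ^ 3 → ‖w t - μ s t (w s)‖ ≤
      (|M| + |N| + Q + (C + (1 + C * T ^ α) * Q)) * modulus α s t ^ 3 := by
    intro K hK hle
    have := modulus_nonneg α s t
    exact hle.trans (by gcongr)
  have aM := abs_nonneg M
  have aN := abs_nonneg N
  rcases le_total s c with hsc | hsc <;> rcases le_total t c with htc | htc
  · refine fin M (by linarith [le_abs_self M]) ?_
    rw [hwy s hsc, hwy t htc]; exact hM s ⟨hs.1, hsc⟩ t ⟨ht.1, htc⟩
  · exact fin Q (by linarith) (across s ⟨hs.1, hsc⟩ t ⟨htc, ht.2⟩)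
  · exact fin _ (by linarith) (h.reverse hα ht' hs' (across t ⟨ht.1, htc⟩ s ⟨hsc, hs.2⟩))
  · refine fin N (by linarith [le_abs_self N]) ?_
    rw [hwz s hsc, hwz t htc]; exact hN s ⟨hsc, hs.2⟩ t ⟨htc, ht.2⟩

/-- Davie solutions satisfy the Davie estimate with a universal constant on short intervals. -/
lemma davieBound_of_exists (h : IsAlmostFlow α T C μ) (hα : 1 / 3 < α) {δ : ℝ}
    (hδ : C * δ ^ α ≤ (1 - bisectFactor α) / 2) {a b : ℝ}
    (ha : 0 ≤ a) (hb : b ≤ T) (hab : b - a ≤ δ) {y : ℝ → W}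
    (hy : ∃ M, DavieBound α μ (Icc a b) M y) :
    DavieBound α μ (Icc a b) (2 * C / (1 - bisectFactor α)) y := by
  obtain ⟨M, hM⟩ := hy
  have hα0 : 0 < α := by linarith
  have hκ0 := bisectFactor_nonneg α
  have hκ1 := bisectFactor_lt_one hα
  have hC := h.nonneg
  set κ := bisectFactor α with hκ
  -- Composition at the midpoint turns a bound `N` into `κ (1 + (1 - κ) / 4) N + C`, by the
  -- smallness of `C * δ ^ α`. The choice `q = (1 + κ) / 2` dominates this factor and has the fixed
  -- point `2 C / (1 - κ)`.
  have key := bound_of_self_improving (S := Icc a b) (f := fun s t => ‖y t - μ s t (y s)‖)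
    (g := fun s t => modulus α s t ^ 3) (q := (1 + κ) / 2) (c := C) (N₀ := |M|)
    (by linarith) (by linarith) hC (abs_nonneg M)
    (fun s hs t ht => (hM.mono subset_rfl (le_abs_self M)) s hs t ht) (by
      intro N hN hyp s hs t ht
      have hu := midpoint_mem_Icc hs ht
      have sub : Icc a b ⊆ Icc 0 T := Icc_subset_Icc ha hb
      obtain ⟨m1, m2⟩ := modulus_midpoint_le hα0 s t
      have e := h.compose (sub hs) (sub hu) (sub ht) m1 m2 (y s) (y ((s + t) / 2)) (y t)
      have e1 := hyp s hs _ hu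
      have e2 := hyp _ hu t ht
      rw [modulus_midpoint_left] at e1
      rw [modulus_midpoint_right] at e2
      have e3 : C * modulus α ((s + t) / 2) t ≤ (1 - κ) / 2 :=
        le_trans (by gcongr; exact modulus_le hα0 ((abs_sub_le_of_mem_Icc hu ht).trans hab)) hδ
      have hm := modulus_nonneg α s t
      calc _ ≤ _ := e
        _ ≤ (1 + (1 - κ) / 2) * (N * (κ / 2 * modulus α s t ^ 3))
            + N * (κ / 2 * modulus α s t ^ 3) + C * modulus α s t ^ 3 := by gcongr
        _ = (κ * (1 + (1 - κ) / 4) * N + C) * modulus α s t ^ 3 := by ring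
        _ ≤ ((1 + κ) / 2 * N + C) * modulus α s t ^ 3 := by
            gcongr
            nlinarith)
  intro s hs t ht
  refine (key s hs t ht).trans (le_of_eq ?_)
  have : 1 - κ ≠ 0 := by linarith
  rw [show 1 - (1 + κ) / 2 = (1 - κ) / 2 by ring]
  field_simp

end IsAlmostFlow

end AlmostFlow

/-! ### Existence of Davie solutions by the Euler scheme -/

namespace IsAlmostFlow

variable {W : Type*} [NormedAddCommGroup W] {α T C : ℝ} {μ : ℝ → ℝ → W → W}

lemma segment_mem_Icc {a b s e r : ℝ} (hs : s ∈ Icc a b) (he : e ∈ Icc a b)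
    (hr : r ∈ Icc (0 : ℝ) 1) : s + r * (e - s) ∈ Icc a b := by
  have := (convex_Icc a b) hs he (by linarith [hr.2] : 0 ≤ 1 - r) hr.1 (by ring)
  simp only [smul_eq_mul] at this
  convert this using 1; ring

/-- Davie estimate for the Euler scheme on the uniform grid from `s` to `e`. -/
lemma exists_euler_grid (h : IsAlmostFlow α T C μ) (hα : 1 / 3 < α) {δ κ : ℝ}
    (hκ : κ = (1 + C * δ ^ α) * (2 / 3 : ℝ) ^ (3 * α - 1)) (hκ₁ : κ < 1) {s e : ℝ}
    (hs : s ∈ Icc 0 T) (he : e ∈ Icc 0 T) (hse : |e - s| ≤ δ) (ζ : W) (n : ℕ) (hn : 0 < n) :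
    ∃ u : ℕ → W, u 0 = ζ ∧ ∀ i k : ℕ, i ≤ k → k ≤ n →
      ‖u k - μ (s + i / n * (e - s)) (s + k / n * (e - s)) (u i)‖ ≤
        C / (1 - κ) * ((k - i : ℕ) * (|e - s| / n)) ^ (3 * α) := by
  have hα0 : 0 < α := by linarith
  have hn' : (0 : ℝ) < n := by exact_mod_cast hn
  have hδ0 : 0 ≤ δ := (abs_nonneg _).trans hse
  set p : ℕ → ℝ := fun i => s + i / n * (e - s) with hp
  have hmem : ∀ i ≤ n, p i ∈ Icc 0 T := fun i hi => segment_mem_Icc hs he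
    ⟨by positivity, by rw [div_le_one hn']; exact_mod_cast hi⟩
  have hdist : ∀ i k : ℕ, i ≤ k → |p k - p i| = (k - i : ℕ) * (|e - s| / n) := by
    intro i k hik
    rw [show p k - p i = ((k - i : ℕ) : ℝ) / n * (e - s) by
      rw [Nat.cast_sub hik, hp]; ring, abs_mul, abs_of_nonneg (by positivity)]
    ring
  let u : ℕ → W := fun k => Nat.rec ζ (fun j x => μ (p j) (p (j + 1)) x) k
  refine ⟨u, rfl, ?_⟩
  have hC := h.nonneg
  -- The sewn quantity vanishes on neighbouring grid points by construction of the scheme. The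
  -- excess `ρ = C * δ ^ α` comes from the Lipschitz constant of `μ` on steps of length at most `δ`.
  -- The grid may run backwards in time.
  refine discrete_sewing (a := fun i k => ‖u k - μ (p i) (p k) (u i)‖) (by positivity) hα
    (by positivity) hC hκ hκ₁ ?_ ?_ ?_
  · intro i hi
    simp [h.apply_self hα0 (hmem i hi)]
  · intro i _
    have : u (i + 1) = μ (p i) (p (i + 1)) (u i) := rfl
    simp [this]
  · intro i j k hij hjk hkn
    have m1 : modulus α (p i) (p j) ≤ ((k - i : ℕ) * (|e - s| / n)) ^ α := modulus_le hα0 (by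
      rw [hdist i j hij]; gcongr)
    have m2 : modulus α (p j) (p k) ≤ ((k - i : ℕ) * (|e - s| / n)) ^ α := modulus_le hα0 (by
      rw [hdist j k hjk]; gcongr)
    have m3 : modulus α (p j) (p k) ≤ δ ^ α := modulus_le hα0 (by
      rw [hdist j k hjk]
      refine le_trans ?_ hse
      rw [mul_div_assoc', div_le_iff₀ hn', mul_comm]
      gcongr
      exact_mod_cast (by omega : k - j ≤ n))
    have e := h.compose (hmem i (by omega)) (hmem j (by omega)) (hmem k hkn) m1 m2
      (u i) (u j) (u k)
    rw [← Real.rpow_natCast, ← Real.rpow_mul (by positivity), mul_comm α] at e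
    refine e.trans ?_
    push_cast
    gcongr

/-- Existence of Davie solutions on short intervals, starting at an endpoint. -/
lemma exists_davie_uIcc [ProperSpace W] (h : IsAlmostFlow α T C μ) (hα : 1 / 3 < α) {δ : ℝ}
    (hδ : (1 + C * δ ^ α) * (2 / 3 : ℝ) ^ (3 * α - 1) < 1) {s e : ℝ}
    (hs : s ∈ Icc 0 T) (he : e ∈ Icc 0 T) (hse : |e - s| ≤ δ) (ζ : W) :
    ∃ y : ℝ → W, y s = ζ ∧ ∃ M, DavieBound α μ (uIcc s e) M y := by
  have hα0 : 0 < α := by linarith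
  rcases eq_or_ne s e with rfl | hne
  · refine ⟨fun _ => ζ, rfl, 0, ?_⟩
    intro t ht t' ht'
    simp only [uIcc_self, mem_singleton_iff] at ht ht'
    subst ht; subst ht'
    simp [h.apply_self hα0 hs]
  have hes : e - s ≠ 0 := sub_ne_zero.2 hne.symm
  obtain ⟨κ, hκ⟩ : ∃ κ, κ = (1 + C * δ ^ α) * (2 / 3 : ℝ) ^ (3 * α - 1) := ⟨_, rfl⟩
  rw [← hκ] at hδ
  have hC := h.nonneg
  have hκ' : 0 < 1 - κ := by linarith
  set M := C / (1 - κ) with hM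
  have hM0 : 0 ≤ M := by positivity
  choose u hu0 hu using fun n : ℕ =>
    h.exists_euler_grid hα hκ hδ hs he hse ζ (n + 1) n.succ_pos
  -- The last grid index not beyond the parameter `r ∈ [0, 1]`, on the grid with `n + 1` steps.
  let idx : ℝ → ℕ → ℕ := fun r n => ⌊r * ((n + 1 : ℕ) : ℝ)⌋₊
  have hidx : ∀ r ∈ Icc (0 : ℝ) 1, ∀ n, idx r n ≤ n + 1 := by
    intro r hr n
    apply Nat.floor_le_of_le
    have : (0 : ℝ) ≤ ((n + 1 : ℕ) : ℝ) := by positivity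
    nlinarith [hr.2]
  have hidx_mono : ∀ r q : ℝ, r ≤ q → ∀ n, idx r n ≤ idx q n := by
    intro r q hrq n
    apply Nat.floor_mono; gcongr
  have hidx_lim : ∀ r ∈ Icc (0 : ℝ) 1,
      Tendsto (fun n => (idx r n : ℝ) / ((n + 1 : ℕ) : ℝ)) atTop (𝓝 r) := by
    intro r hr
    exact (tendsto_nat_floor_mul_div_atTop hr.1).comp
      (tendsto_natCast_atTop_atTop.comp (tendsto_add_atTop_nat 1))
  -- Along an ultrafilter the bounded Euler values converge at every parameter simultaneously,
  -- without passing to subsequences.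
  set F : Filter ℕ := (hyperfilter ℕ : Filter ℕ) with hF
  have hFle : F ≤ atTop := Nat.hyperfilter_le_atTop
  have hT : 0 ≤ T := hs.1.trans hs.2
  have hbdd : ∀ r ∈ Icc (0 : ℝ) 1, ∀ n, u n (idx r n) ∈
      Metric.closedBall ζ (M * T ^ (3 * α) + C * T ^ α) := by
    intro r hr n
    have h1 := hu n 0 (idx r n) (Nat.zero_le _) (hidx r hr n)
    have hn : (0 : ℝ) < ((n + 1 : ℕ) : ℝ) := by positivity
    have hp : s + (idx r n : ℝ) / ((n + 1 : ℕ) : ℝ) * (e - s) ∈ Icc 0 T := segment_mem_Icc hs he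
      ⟨by positivity, by rw [div_le_one hn]; exact_mod_cast hidx r hr n⟩
    have hes' : |e - s| ≤ T := by simpa using abs_sub_le_of_mem_Icc hs he
    rw [hu0] at h1
    simp only [Nat.cast_zero, zero_div, zero_mul, add_zero] at h1
    have h2 := h.dist_id s hs _ hp ζ
    have h3 : modulus α s (s + (idx r n : ℝ) / ((n + 1 : ℕ) : ℝ) * (e - s)) ≤ T ^ α :=
      modulus_le hα0 (by simpa using abs_sub_le_of_mem_Icc hs hp)
    have h4 : ((idx r n - 0 : ℕ) : ℝ) * (|e - s| / ((n + 1 : ℕ) : ℝ)) ≤ T := by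
      refine le_trans ?_ hes'
      rw [mul_div_assoc', div_le_iff₀ hn, mul_comm]
      gcongr
      exact_mod_cast hidx r hr n
    rw [mem_closedBall_iff_norm]
    calc ‖u n (idx r n) - ζ‖ ≤ _ := norm_sub_le_norm_sub_add_norm_sub _
          (μ s (s + (idx r n : ℝ) / ((n + 1 : ℕ) : ℝ) * (e - s)) ζ) _
      _ ≤ M * (((idx r n - 0 : ℕ) : ℝ) * (|e - s| / ((n + 1 : ℕ) : ℝ))) ^ (3 * α)
          + C * modulus α s (s + (idx r n : ℝ) / ((n + 1 : ℕ) : ℝ) * (e - s)) := add_le_add h1 h2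
      _ ≤ _ := by gcongr
  have hlim : ∀ r : ℝ, ∃ w : W, r ∈ Icc (0 : ℝ) 1 →
      Tendsto (fun n => u n (idx r n)) F (𝓝 w) := by
    intro r
    by_cases hr : r ∈ Icc (0 : ℝ) 1
    · obtain ⟨w, -, hw⟩ := (isCompact_closedBall ζ _).ultrafilter_le_nhds
        ((hyperfilter ℕ).map fun n => u n (idx r n))
        (le_principal_iff.2 (Ultrafilter.mem_map.2 (Filter.univ_mem' (hbdd r hr))))
      exact ⟨w, fun _ => hw⟩
    · exact ⟨ζ, fun h => (hr h).elim⟩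
  choose w hw using hlim
  have hw0 : w 0 = ζ := by
    refine tendsto_nhds_unique (hw 0 ⟨le_rfl, zero_le_one⟩) ?_
    simp only [idx, zero_mul, Nat.floor_zero, hu0]
    exact tendsto_const_nhds
  -- The grid estimate passes to the limit for parameters ordered along the scheme; the opposite
  -- order is recovered by `reverse` at the end.
  have hdir : ∀ r ∈ Icc (0 : ℝ) 1, ∀ q ∈ Icc (0 : ℝ) 1, r ≤ q →
      ‖w q - μ (s + r * (e - s)) (s + q * (e - s)) (w r)‖ ≤ M * ((q - r) * |e - s|) ^ (3 * α) := by
    intro r hr q hq hrq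
    set c : ℝ → ℕ → ℝ := fun r n => s + (idx r n : ℝ) / ((n + 1 : ℕ) : ℝ) * (e - s) with hc
    have hcm : ∀ r ∈ Icc (0 : ℝ) 1, ∀ n, c r n ∈ Icc 0 T := fun r hr n => segment_mem_Icc hs he
      ⟨by positivity, by rw [div_le_one (by positivity)]; exact_mod_cast hidx r hr n⟩
    have hcl : ∀ r ∈ Icc (0 : ℝ) 1, Tendsto (c r) F (𝓝 (s + r * (e - s))) := fun r hr =>
      (((hidx_lim r hr).mono_left hFle).mul_const _).const_add s
    have t1 : Tendsto (fun n => μ (c r n) (c q n) (w r)) F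
        (𝓝 (μ (s + r * (e - s)) (s + q * (e - s)) (w r))) := by
      have hcont := h.cont (w r) (s + r * (e - s), s + q * (e - s))
        ⟨segment_mem_Icc hs he hr, segment_mem_Icc hs he hq⟩
      exact hcont.tendsto.comp (tendsto_nhdsWithin_iff.2
        ⟨(hcl r hr).prodMk_nhds (hcl q hq), Eventually.of_forall fun n => ⟨hcm r hr n, hcm q hq n⟩⟩)
    -- Times and argument of `μ` both move with `n`. The Lipschitz bound, uniform in time, fixes the
    -- argument; then `cont` handles the times.
    have t2 : Tendsto (fun n => μ (c r n) (c q n) (u n (idx r n)) - μ (c r n) (c q n) (w r)) F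
        (𝓝 0) := by
      have : Tendsto (fun n => (1 + C * T ^ α) * ‖u n (idx r n) - w r‖) F (𝓝 0) := by
        have := (tendsto_iff_norm_sub_tendsto_zero.1 (hw r hr)).const_mul (1 + C * T ^ α)
        simpa using this
      refine squeeze_zero_norm (fun n => ?_) this
      refine (h.lip _ (hcm r hr n) _ (hcm q hq n) _ _).trans ?_
      gcongr
      exact modulus_le hα0 (by simpa using abs_sub_le_of_mem_Icc (hcm r hr n) (hcm q hq n))
    have t3 : Tendsto (fun n => ‖u n (idx q n) - μ (c r n) (c q n) (u n (idx r n))‖) F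
        (𝓝 ‖w q - μ (s + r * (e - s)) (s + q * (e - s)) (w r)‖) := by
      refine ((hw q hq).sub ?_).norm
      simpa using t2.add t1
    have t4 : Tendsto (fun n => M * (((idx q n : ℝ) / ((n + 1 : ℕ) : ℝ)
        - (idx r n : ℝ) / ((n + 1 : ℕ) : ℝ)) * |e - s|) ^ (3 * α)) F
        (𝓝 (M * ((q - r) * |e - s|) ^ (3 * α))) := by
      refine Tendsto.const_mul _ (Tendsto.rpow_const ?_ (Or.inr (by linarith)))
      exact (((hidx_lim q hq).mono_left hFle).sub ((hidx_lim r hr).mono_left hFle)).mul_const _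
    refine le_of_tendsto_of_tendsto' t3 t4 fun n => ?_
    have := hu n (idx r n) (idx q n) (hidx_mono r q hrq n) (hidx q hq n)
    rw [Nat.cast_sub (hidx_mono r q hrq n)] at this
    refine this.trans (le_of_eq ?_)
    congr 2; ring
  have hpar : ∀ t ∈ uIcc s e, (t - s) / (e - s) ∈ Icc (0 : ℝ) 1 := by
    intro t ht
    rcases le_total s e with hle | hle
    · have : 0 < e - s := lt_of_le_of_ne (by linarith) hes.symm
      rw [uIcc_of_le hle] at ht
      exact ⟨div_nonneg (by linarith [ht.1]) this.le, by rw [div_le_one this]; linarith [ht.2]⟩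
    · have : e - s < 0 := lt_of_le_of_ne (by linarith) hes
      rw [uIcc_of_ge hle] at ht
      exact ⟨div_nonneg_of_nonpos (by linarith [ht.2]) this.le,
        by rw [div_le_one_of_neg this]; linarith [ht.1]⟩
  have hval : ∀ t, s + (t - s) / (e - s) * (e - s) = t := fun t => by field_simp; ring
  have hsub : uIcc s e ⊆ Icc 0 T := uIcc_subset_Icc hs he
  have fwd : ∀ t ∈ uIcc s e, ∀ t' ∈ uIcc s e, (t - s) / (e - s) ≤ (t' - s) / (e - s) →
      ‖w ((t' - s) / (e - s)) - μ t t' (w ((t - s) / (e - s)))‖ ≤ M * modulus α t t' ^ 3 := by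
    intro t ht t' ht' hle
    have := hdir _ (hpar t ht) _ (hpar t' ht') hle
    rw [hval, hval] at this
    rw [modulus_pow_eq]
    refine this.trans (le_of_eq ?_)
    congr 2
    have e1 : (t' - s) / (e - s) - (t - s) / (e - s) = (t' - t) / (e - s) := by ring
    rw [← abs_of_nonneg (sub_nonneg.2 hle), ← abs_mul, e1, div_mul_cancel₀ _ hes]
  refine ⟨fun t => w ((t - s) / (e - s)), by simp [hw0],
    max M (C + (1 + C * T ^ α) * M), ?_⟩
  intro t ht t' ht'
  have hm := pow_nonneg (modulus_nonneg α t t') 3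
  rcases le_total ((t - s) / (e - s)) ((t' - s) / (e - s)) with hle | hle
  · exact (fwd t ht t' ht' hle).trans (by gcongr; exact le_max_left _ _)
  · refine (h.reverse hα0 (hsub ht') (hsub ht) (fwd t' ht' t ht hle)).trans ?_
    gcongr; exact le_max_right _ _

/-- Existence of Davie solutions through an arbitrary point. -/
theorem exists_davie [ProperSpace W] (h : IsAlmostFlow α T C μ) (hα : 1 / 3 < α) {s : ℝ}
    (hs : s ∈ Icc 0 T) (ζ : W) :
    ∃ y : ℝ → W, y s = ζ ∧ ∃ M, DavieBound α μ (Icc 0 T) M y := by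
  have hα0 : 0 < α := by linarith
  have hκ : (2 / 3 : ℝ) ^ (3 * α - 1) < 1 :=
    Real.rpow_lt_one (by norm_num) (by norm_num) (by linarith)
  have hκ0 : (0 : ℝ) < (2 / 3 : ℝ) ^ (3 * α - 1) := by positivity
  obtain ⟨δ, hδ0, hδ⟩ := exists_rpow_small hα0 (C * (2 / 3 : ℝ) ^ (3 * α - 1))
    (ε := (1 - (2 / 3 : ℝ) ^ (3 * α - 1)) / 2) (by linarith)
  have hδ' : (1 + C * δ ^ α) * (2 / 3 : ℝ) ^ (3 * α - 1) < 1 := by nlinarith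
  -- Doubling the admissible length: a solution on the half containing `s` is continued across the
  -- midpoint. Letting `s` be any point of the interval allows continuation to the left as well.
  have key : ∀ n : ℕ, ∀ a b : ℝ, 0 ≤ a → b ≤ T → b - a ≤ 2 ^ n * δ → ∀ s ∈ Icc a b, ∀ ζ : W,
      ∃ y : ℝ → W, y s = ζ ∧ ∃ M, DavieBound α μ (Icc a b) M y := by
    intro n
    induction n with
    | zero =>
      intro a b ha hb hab s hs ζ
      have hab' := hs.1.trans hs.2
      have hs' : s ∈ Icc 0 T := ⟨by linarith [hs.1], by linarith [hs.2]⟩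
      rw [pow_zero, one_mul] at hab
      obtain ⟨y, hy, hyM⟩ := h.exists_davie_uIcc hα hδ' hs' (e := a) ⟨ha, by linarith⟩
        ((abs_sub_le_of_mem_Icc hs ⟨le_rfl, hab'⟩).trans hab) ζ
      obtain ⟨z, hz, hzM⟩ := h.exists_davie_uIcc hα hδ' hs' (e := b) ⟨by linarith, hb⟩
        ((abs_sub_le_of_mem_Icc hs ⟨hab', le_rfl⟩).trans hab) ζ
      rw [uIcc_of_ge hs.1] at hyM
      rw [uIcc_of_le hs.2] at hzM
      exact ⟨_, by simp [hy], h.glue hα0 ha hs.1 hs.2 hb hyM hzM (by rw [hy, hz])⟩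
    | succ n ih =>
      intro a b ha hb hab s hs ζ
      have hab' := hs.1.trans hs.2
      rw [pow_succ] at hab
      set c := (a + b) / 2 with hc
      rcases le_total s c with hsc | hsc
      · obtain ⟨y, hy, hyM⟩ := ih a c ha (by linarith) (by linarith) s ⟨hs.1, hsc⟩ ζ
        obtain ⟨z, hz, hzM⟩ := ih c b (by linarith) hb (by linarith) c ⟨le_rfl, by linarith⟩ (y c)
        exact ⟨_, by simp [hsc, hy], h.glue hα0 ha (by linarith) (by linarith) hb hyM hzM hz.symm⟩
      · obtain ⟨z, hz, hzM⟩ := ih c b (by linarith) hb (by linarith) s ⟨hsc, hs.2⟩ ζ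
        obtain ⟨y, hy, hyM⟩ := ih a c ha (by linarith) (by linarith) c ⟨by linarith, le_rfl⟩ (z c)
        refine ⟨_, ?_, h.glue hα0 ha (by linarith) (by linarith) hb hyM hzM hy⟩
        rcases hsc.eq_or_lt with hsc | hsc
        · simp [← hsc, hy, ← hsc ▸ hz]
        · simp [not_le.2 hsc, hz]
  obtain ⟨n, hn⟩ := pow_unbounded_of_one_lt (T / δ) (one_lt_two)
  rw [div_lt_iff₀ hδ0] at hn
  exact key n 0 T le_rfl le_rfl (by linarith) s hs ζ

end IsAlmostFlow

/-! ### Rough drivers and equations with drift -/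

/-- Here `p ≥ 2` enters: `1 - 2α ≥ 0`, so a time step is at most of the order of the second level of
the rough path. -/
lemma abs_sub_le_modulus_sq {α T s t : ℝ} (hα : α ≤ 1 / 2) (hs : s ∈ Icc 0 T) (ht : t ∈ Icc 0 T) :
    |t - s| ≤ T ^ (1 - 2 * α) * modulus α s t ^ 2 := by
  have hT : 0 ≤ T := hs.1.trans hs.2
  rcases eq_or_ne (|t - s|) 0 with h | h
  · rw [h]; have := modulus_nonneg α s t; positivity
  · have hpos : 0 < |t - s| := lt_of_le_of_ne (abs_nonneg _) h.symm
    have hle : |t - s| ≤ T := by simpa using abs_sub_le_of_mem_Icc hs ht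
    rw [modulus_pow_eq]
    calc |t - s| = |t - s| ^ (1 - 2 * α) * |t - s| ^ (2 * α) := by
          rw [← Real.rpow_add hpos]; simp
      _ ≤ _ := by
          push_cast
          gcongr
          linarith

lemma modulus_le_rpow {α T s t : ℝ} (hα : 0 < α) (hs : s ∈ Icc 0 T) (ht : t ∈ Icc 0 T) :
    modulus α s t ≤ T ^ α := modulus_le hα (by simpa using abs_sub_le_of_mem_Icc hs ht)

section Driver

variable {W : Type*} [NormedAddCommGroup W]

/-- The error of a two-parameter family of vector fields in the composition of time steps. -/
def driverDefect (V : ℝ → ℝ → W → W) (s u t : ℝ) (ξ : W) : W :=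
  V u t (ξ + V s u ξ) + V s u ξ - V s t ξ

/-- A rough driver: vector fields `V s t` of order `|t - s| ^ α`, with Lipschitz derivatives, whose
composition defect is of order `|t - s| ^ (3 α)` in the Lipschitz norm. -/
structure IsRoughDriver (α T C : ℝ) (V : ℝ → ℝ → W → W) : Prop where
  nonneg : 0 ≤ C
  norm_le : ∀ s ∈ Icc 0 T, ∀ t ∈ Icc 0 T, ∀ ξ, ‖V s t ξ‖ ≤ C * modulus α s t
  lip : ∀ s ∈ Icc 0 T, ∀ t ∈ Icc 0 T, ∀ ξ ζ, ‖V s t ξ - V s t ζ‖ ≤ C * modulus α s t * ‖ξ - ζ‖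
  rect : ∀ s ∈ Icc 0 T, ∀ t ∈ Icc 0 T, ∀ a c k,
    ‖V s t (a + k) - V s t a - (V s t (c + k) - V s t c)‖ ≤
      C * modulus α s t * (‖a - c‖ * ‖k‖)
  defect_le : ∀ s ∈ Icc 0 T, ∀ u ∈ Icc 0 T, ∀ t ∈ Icc 0 T, ∀ r, modulus α s u ≤ r →
    modulus α u t ≤ r → ∀ ξ, ‖driverDefect V s u t ξ‖ ≤ C * r ^ 3
  defect_lip : ∀ s ∈ Icc 0 T, ∀ u ∈ Icc 0 T, ∀ t ∈ Icc 0 T, ∀ r, modulus α s u ≤ r →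
    modulus α u t ≤ r → ∀ ξ ζ,
      ‖driverDefect V s u t ξ - driverDefect V s u t ζ‖ ≤ C * r ^ 3 * ‖ξ - ζ‖
  cont : ∀ ξ, ContinuousOn (fun q : ℝ × ℝ => V q.1 q.2 ξ) (Icc 0 T ×ˢ Icc 0 T)

/-- A bounded Lipschitz vector field. -/
structure IsBoundedLipschitz (B : ℝ) (b : W → W) : Prop where
  nonneg : 0 ≤ B
  norm_le : ∀ z, ‖b z‖ ≤ B
  lip : ∀ z w, ‖b z - b w‖ ≤ B * ‖z - w‖

lemma IsBoundedLipschitz.continuous {B : ℝ} {b : W → W} (hb : IsBoundedLipschitz B b) :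
    Continuous b :=
  (LipschitzWith.of_dist_le_mul (K := ⟨B, hb.nonneg⟩) fun z w => by
    rw [dist_eq_norm, dist_eq_norm]; exact hb.lip z w).continuous

lemma IsBoundedLipschitz.intervalIntegrable {B : ℝ} {b : W → W} (hb : IsBoundedLipschitz B b)
    {a c : ℝ} {y : ℝ → W} (hy : ContinuousOn y (Icc a c)) {s t : ℝ} (hs : s ∈ Icc a c)
    (ht : t ∈ Icc a c) : IntervalIntegrable (fun r => b (y r)) volume s t :=
  (hb.continuous.comp_continuousOn (hy.mono (uIcc_subset_Icc hs ht))).intervalIntegrable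

lemma continuousOn_of_modulus_bound {Z : Type*} [SeminormedAddCommGroup Z] {α H : ℝ} (hα : 0 < α)
    {S : Set ℝ} {y : ℝ → Z}
    (h : ∀ s ∈ S, ∀ t ∈ S, ‖y t - y s‖ ≤ H * modulus α s t) : ContinuousOn y S := by
  intro t ht
  rw [ContinuousWithinAt, tendsto_iff_norm_sub_tendsto_zero]
  have : Tendsto (fun s => H * modulus α s t) (𝓝[S] t) (𝓝 0) := by
    simpa using ((tendsto_modulus hα t).mono_left nhdsWithin_le_nhds).const_mul H
  refine squeeze_zero' (Eventually.of_forall fun _ => norm_nonneg _) ?_ this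
  filter_upwards [self_mem_nhdsWithin] with s hs
  rw [norm_sub_rev]
  exact h s hs t ht

namespace IsRoughDriver

variable {α T C : ℝ} {V : ℝ → ℝ → W → W}

/-- Base point and increment both vary between two solutions. Passing through `c + k` separates a
second difference with common increment from a plain Lipschitz estimate. -/
lemma mixed (hV : IsRoughDriver α T C V) {s t : ℝ} (hs : s ∈ Icc 0 T) (ht : t ∈ Icc 0 T)
    (a c k l : W) :
    ‖V s t (a + k) - V s t a - (V s t (c + l) - V s t c)‖ ≤
      C * modulus α s t * (‖k - l‖ + ‖a - c‖ * ‖k‖) := by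
  have h1 := hV.rect s hs t ht a c k
  have h2 := hV.lip s hs t ht (c + k) (c + l)
  rw [add_sub_add_left_eq_sub] at h2
  calc _ = ‖(V s t (a + k) - V s t a - (V s t (c + k) - V s t c))
        + (V s t (c + k) - V s t (c + l))‖ := by congr 1; abel
    _ ≤ _ := norm_add_le _ _
    _ ≤ _ := by linarith

end IsRoughDriver

variable [NormedSpace ℝ W]

/-- One step of the Euler scheme for the equation with drift `b` and driver `V`. -/
def driftFlow (b : W → W) (V : ℝ → ℝ → W → W) (s t : ℝ) (ξ : W) : W :=
  ξ + (t - s) • b ξ + V s t ξ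

/-- The error of the one-step expansion of `y`, with the exact drift. -/
noncomputable def stepError (b : W → W) (V : ℝ → ℝ → W → W) (y : ℝ → W) (s t : ℝ) : W :=
  y t - y s - (∫ r in s..t, b (y r)) - V s t (y s)

namespace IsRoughDriver

variable {α T C B : ℝ} {V : ℝ → ℝ → W → W} {b : W → W}

/-- Besides the defect of the driver, the composition contains the drift at a displaced point and
the driver at an argument shifted by a drift step. Each is a time step, of order `r ^ 2`, times a
quantity of order `r`. The constant is chosen before the driver. -/
theorem exists_isAlmostFlow (hα : 1 / 3 < α) (hα' : α ≤ 1 / 2) (hT : 0 ≤ T)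
    (hb : IsBoundedLipschitz B b) (C : ℝ) : ∃ C', ∀ V, IsRoughDriver α T C V →
      IsAlmostFlow α T C' (driftFlow b V) := by
  have hα0 : 0 < α := by linarith
  obtain ⟨Θ, hΘ⟩ : ∃ Θ, Θ = T ^ (1 - 2 * α) := ⟨_, rfl⟩
  obtain ⟨Ω, hΩ⟩ : ∃ Ω, Ω = T ^ α := ⟨_, rfl⟩
  have hΘ0 : 0 ≤ Θ := hΘ ▸ Real.rpow_nonneg hT _
  have hΩ0 : 0 ≤ Ω := hΩ ▸ Real.rpow_nonneg hT _
  obtain ⟨C₁, hC₁⟩ : ∃ C₁, C₁ = B * Θ * Ω + C := ⟨_, rfl⟩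
  -- `C₁` serves the distance to the identity and the Lipschitz bound; the other three summands
  -- bound the composition error.
  refine ⟨C₁ + B * Θ * C₁ + C * B * Θ + C, fun V hV => ?_⟩
  have hB := hb.nonneg
  have hC := hV.nonneg
  have hC₁0 : 0 ≤ C₁ := by rw [hC₁]; positivity
  have habs : ∀ s ∈ Icc 0 T, ∀ t ∈ Icc 0 T, |t - s| ≤ Θ * modulus α s t ^ 2 :=
    fun s hs t ht => hΘ ▸ abs_sub_le_modulus_sq hα' hs ht
  have hmod : ∀ s ∈ Icc 0 T, ∀ t ∈ Icc 0 T, modulus α s t ≤ Ω :=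
    fun s hs t ht => hΩ ▸ modulus_le_rpow hα0 hs ht
  have habs' : ∀ s ∈ Icc 0 T, ∀ t ∈ Icc 0 T, |t - s| ≤ Θ * Ω * modulus α s t := by
    intro s hs t ht
    have h0 := modulus_nonneg α s t
    calc |t - s| ≤ Θ * modulus α s t ^ 2 := habs s hs t ht
      _ = Θ * modulus α s t * modulus α s t := by ring
      _ ≤ Θ * Ω * modulus α s t := by gcongr; exact hmod s hs t ht
  have hdist : ∀ s ∈ Icc 0 T, ∀ t ∈ Icc 0 T, ∀ ξ, ‖driftFlow b V s t ξ - ξ‖ ≤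
      C₁ * modulus α s t := by
    intro s hs t ht ξ
    calc ‖driftFlow b V s t ξ - ξ‖ = ‖(t - s) • b ξ + V s t ξ‖ := by
          congr 1; rw [driftFlow]; abel
      _ ≤ |t - s| * ‖b ξ‖ + ‖V s t ξ‖ := by
          refine (norm_add_le _ _).trans_eq ?_
          rw [norm_smul, Real.norm_eq_abs]
      _ ≤ (Θ * Ω * modulus α s t) * B + C * modulus α s t := by
          have := modulus_nonneg α s t
          gcongr
          · exact habs' s hs t ht
          · exact hb.norm_le ξ
          · exact hV.norm_le s hs t ht ξ
      _ = C₁ * modulus α s t := by rw [hC₁]; ring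
  have hle : C₁ ≤ C₁ + B * Θ * C₁ + C * B * Θ + C := by
    have : 0 ≤ B * Θ * C₁ + C * B * Θ + C := by positivity
    linarith
  refine ⟨by positivity, ?_, ?_, ?_, ?_⟩
  · intro s hs t ht ξ
    have := modulus_nonneg α s t
    exact (hdist s hs t ht ξ).trans (by gcongr)
  · intro s hs t ht ξ ζ
    have h0 := modulus_nonneg α s t
    calc ‖driftFlow b V s t ξ - driftFlow b V s t ζ‖
        = ‖(ξ - ζ) + (t - s) • (b ξ - b ζ) + (V s t ξ - V s t ζ)‖ := by
          congr 1; rw [driftFlow, driftFlow, smul_sub]; abel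
      _ ≤ ‖ξ - ζ‖ + |t - s| * ‖b ξ - b ζ‖ + ‖V s t ξ - V s t ζ‖ := by
          refine norm_add₃_le.trans_eq ?_
          rw [norm_smul, Real.norm_eq_abs]
      _ ≤ ‖ξ - ζ‖ + (Θ * Ω * modulus α s t) * (B * ‖ξ - ζ‖) + C * modulus α s t * ‖ξ - ζ‖ := by
          gcongr
          · exact habs' s hs t ht
          · exact hb.lip ξ ζ
          · exact hV.lip s hs t ht ξ ζ
      _ = (1 + C₁ * modulus α s t) * ‖ξ - ζ‖ := by rw [hC₁]; ring
      _ ≤ _ := by gcongr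
  · intro s hs u hu t ht r hsu hut ξ
    have h0 := modulus_nonneg α s u
    have h0' := modulus_nonneg α u t
    have hr : 0 ≤ r := h0.trans hsu
    calc ‖driftFlow b V u t (driftFlow b V s u ξ) - driftFlow b V s t ξ‖
        = ‖(t - u) • (b (driftFlow b V s u ξ) - b ξ)
          + (V u t ((ξ + V s u ξ) + (u - s) • b ξ) - V u t (ξ + V s u ξ))
          + driverDefect V s u t ξ‖ := by
          have e : (ξ + V s u ξ) + (u - s) • b ξ = driftFlow b V s u ξ := by
            rw [driftFlow]; abel
          rw [e, driverDefect]
          nth_rewrite 1 [driftFlow]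
          rw [driftFlow.eq_def b V s t]
          nth_rewrite 1 [driftFlow.eq_def b V s u]
          congr 1
          module
      _ ≤ |t - u| * ‖b (driftFlow b V s u ξ) - b ξ‖
          + ‖V u t ((ξ + V s u ξ) + (u - s) • b ξ) - V u t (ξ + V s u ξ)‖
          + ‖driverDefect V s u t ξ‖ := by
          refine norm_add₃_le.trans_eq ?_
          rw [norm_smul, Real.norm_eq_abs]
      _ ≤ (Θ * r ^ 2) * (B * (C₁ * r)) + C * r * (Θ * r ^ 2 * B) + C * r ^ 3 := by
          have e1 : |t - u| ≤ Θ * r ^ 2 := (habs u hu t ht).trans (by gcongr)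
          have e2 : |u - s| ≤ Θ * r ^ 2 := (habs s hs u hu).trans (by gcongr)
          have e3 : ‖b (driftFlow b V s u ξ) - b ξ‖ ≤ B * (C₁ * r) :=
            (hb.lip _ _).trans (by gcongr; exact (hdist s hs u hu ξ).trans (by gcongr))
          have e4 := hV.lip u hu t ht ((ξ + V s u ξ) + (u - s) • b ξ) (ξ + V s u ξ)
          rw [add_sub_cancel_left, norm_smul, Real.norm_eq_abs] at e4
          have e5 : |u - s| * ‖b ξ‖ ≤ Θ * r ^ 2 * B := by gcongr; exact hb.norm_le ξ
          have e6 : C * modulus α u t * (|u - s| * ‖b ξ‖) ≤ C * r * (Θ * r ^ 2 * B) := by gcongr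
          have e7 := hV.defect_le s hs u hu t ht r hsu hut ξ
          have e8 : |t - u| * ‖b (driftFlow b V s u ξ) - b ξ‖ ≤ (Θ * r ^ 2) * (B * (C₁ * r)) := by
            gcongr
          linarith
      _ = (B * Θ * C₁ + C * B * Θ + C) * r ^ 3 := by ring
      _ ≤ _ := by gcongr; linarith
  · intro ξ
    unfold driftFlow
    exact (continuousOn_const.add (by fun_prop)).add (hV.cont ξ)

variable {a c : ℝ}

lemma norm_drift_integral_le (hb : IsBoundedLipschitz B b) (y : ℝ → W) (s t : ℝ) :
    ‖∫ r in s..t, b (y r)‖ ≤ B * |t - s| :=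
  intervalIntegral.norm_integral_le_of_norm_le_const fun _ _ => hb.norm_le _

/-- The drift integral is close to its one-step approximation. -/
lemma norm_drift_integral_sub_le [CompleteSpace W] (hα : 0 < α) (hb : IsBoundedLipschitz B b)
    {y : ℝ → W} {H : ℝ} (hy : ∀ s ∈ Icc a c, ∀ t ∈ Icc a c, ‖y t - y s‖ ≤ H * modulus α s t)
    (hH : 0 ≤ H) {s t : ℝ} (hs : s ∈ Icc a c) (ht : t ∈ Icc a c) :
    ‖(∫ r in s..t, b (y r)) - (t - s) • b (y s)‖ ≤ B * H * modulus α s t * |t - s| := by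
  have hB := hb.nonneg
  have hint := hb.intervalIntegrable (continuousOn_of_modulus_bound hα hy) hs ht
  rw [← intervalIntegral.integral_const, ← intervalIntegral.integral_sub hint (by simp)]
  refine intervalIntegral.norm_integral_le_of_norm_le_const fun r hr => ?_
  have hr' : r ∈ uIcc s t := uIoc_subset_uIcc hr
  calc ‖b (y r) - b (y s)‖ ≤ B * (H * modulus α s r) :=
        (hb.lip _ _).trans (by gcongr; exact hy s hs r (uIcc_subset_Icc hs ht hr'))
    _ ≤ B * (H * modulus α s t) := by
        gcongr
        exact modulus_mono hα (abs_sub_left_of_mem_uIcc hr')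
    _ = _ := by ring

/-- The step errors of two solutions with different initial values differ by a multiple of the
distance of the solutions. -/
lemma stepError_sub_le [CompleteSpace W] (hV : IsRoughDriver α T C V) (hα : 1 / 3 < α)
    (hα' : α ≤ 1 / 2) (hb : IsBoundedLipschitz B b) {δ Θ Ω E M : ℝ}
    (hδ : C * δ ^ α ≤ (1 - bisectFactor α) / 2) (hΘ : Θ = T ^ (1 - 2 * α)) (hΩ : Ω = T ^ α)
    (hE : E = B * Θ + M * Ω) (hM : 0 ≤ M) (ha : 0 ≤ a) (hc : c ≤ T) (hac : c - a ≤ δ)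
    {y z : ℝ → W} (hy : ContinuousOn y (Icc a c)) (hz : ContinuousOn z (Icc a c))
    (hyM : ∀ s ∈ Icc a c, ∀ t ∈ Icc a c, ‖stepError b V y s t‖ ≤ M * modulus α s t ^ 3)
    (hzM : ∀ s ∈ Icc a c, ∀ t ∈ Icc a c, ‖stepError b V z s t‖ ≤ M * modulus α s t ^ 3)
    {S : ℝ} (hS : ∀ r ∈ Icc a c, ‖y r - z r‖ ≤ S) :
    ∀ s ∈ Icc a c, ∀ t ∈ Icc a c, ‖stepError b V y s t - stepError b V z s t‖ ≤
      2 * ((C * (B * Θ + (1 + C * Ω) * E) + C) * S) / (1 - bisectFactor α) *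
        modulus α s t ^ 3 := by
  have hα0 : 0 < α := by linarith
  have hκ0 := bisectFactor_nonneg α
  have hκ1 := bisectFactor_lt_one hα
  set κ := bisectFactor α
  have hC := hV.nonneg
  have hB := hb.nonneg
  intro s₀ hs₀ t₀ ht₀
  have hS0 : 0 ≤ S := (norm_nonneg _).trans (hS s₀ hs₀)
  have sub : Icc a c ⊆ Icc 0 T := Icc_subset_Icc ha hc
  have hT : 0 ≤ T := (sub hs₀).1.trans (sub hs₀).2
  have hΘ0 : 0 ≤ Θ := hΘ ▸ Real.rpow_nonneg hT _
  have hΩ0 : 0 ≤ Ω := hΩ ▸ Real.rpow_nonneg hT _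
  have hE0 : 0 ≤ E := by rw [hE]; positivity
  set Q := (C * (B * Θ + (1 + C * Ω) * E) + C) * S with hQ
  have hQ0 : 0 ≤ Q := by positivity
  -- The exact drift integrals cancel by additivity, leaving only terms in `V`. One-step drifts
  -- would leave second differences of `b`, for which the Lipschitz bound gives no factor `S` times
  -- a positive power of the modulus.
  have hadd : ∀ w : ℝ → W, ContinuousOn w (Icc a c) → ∀ s ∈ Icc a c, ∀ u ∈ Icc a c,
      ∀ t ∈ Icc a c, stepError b V w s t = stepError b V w s u + stepError b V w u t
        + (V u t ((w s + V s u (w s)) + (w u - (w s + V s u (w s))))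
          - V u t (w s + V s u (w s))) + driverDefect V s u t (w s) := by
    intro w hw s hs u hu t ht
    rw [add_sub_cancel, driverDefect, stepError, stepError, stepError,
      ← intervalIntegral.integral_add_adjacent_intervals
        (hb.intervalIntegrable hw hs hu) (hb.intervalIntegrable hw hu ht)]
    abel
  have hdrift : ∀ s ∈ Icc a c, ∀ t ∈ Icc a c,
      ‖(∫ r in s..t, b (y r)) - ∫ r in s..t, b (z r)‖ ≤ B * S * |t - s| := by
    intro s hs t ht
    rw [← intervalIntegral.integral_sub (hb.intervalIntegrable hy hs ht)
      (hb.intervalIntegrable hz hs ht)]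
    refine intervalIntegral.norm_integral_le_of_norm_le_const fun r hr => ?_
    refine (hb.lip _ _).trans ?_
    gcongr
    exact hS r (uIcc_subset_Icc hs ht (uIoc_subset_uIcc hr))
  -- The triangle inequality provides the finite start `M + M`; the resulting bound no longer has it
  -- and is proportional to `S`.
  have key := bound_of_self_improving (S := Icc a c)
    (f := fun s t => ‖stepError b V y s t - stepError b V z s t‖)
    (g := fun s t => modulus α s t ^ 3) (q := (1 + κ) / 2) (c := Q) (N₀ := M + M)
    (by linarith) (by linarith) hQ0 (by linarith)
    (fun s hs t ht => by
      refine (norm_sub_le _ _).trans ?_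
      rw [add_mul]
      exact add_le_add (hyM s hs t ht) (hzM s hs t ht)) (by
    intro N hN hyp s hs t ht
    obtain ⟨m1, m2⟩ := modulus_midpoint_le hα0 s t
    have hu := midpoint_mem_Icc hs ht
    have d1 := hyp s hs _ hu
    have d2 := hyp _ hu t ht
    have d1' : ‖stepError b V y s ((s + t) / 2) - stepError b V z s ((s + t) / 2)‖ ≤
      N * modulus α s t ^ 3 := d1.trans (by
        have := modulus_nonneg α s ((s + t) / 2); gcongr)
    rw [modulus_midpoint_left] at d1
    rw [modulus_midpoint_right] at d2
    set u := (s + t) / 2 with hu_def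
    set ω := modulus α s t with hω
    have hω0 : 0 ≤ ω := modulus_nonneg α s t
    have hsu0 := modulus_nonneg α s u
    have hut0 := modulus_nonneg α u t
    have hωδ : C * ω ≤ (1 - κ) / 2 :=
      le_trans (by gcongr; exact modulus_le hα0 ((abs_sub_le_of_mem_Icc hs ht).trans hac)) hδ
    have hωΩ : ω ≤ Ω := hΩ ▸ modulus_le_rpow hα0 (sub hs) (sub ht)
    have hsu : |u - s| ≤ Θ * ω ^ 2 := by
      rw [hΘ]
      refine (abs_sub_le_modulus_sq hα' (sub hs) (sub hu)).trans ?_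
      gcongr
    -- The deviation of the path at the midpoint from a pure driver step: of order `ω ^ 2` for each
    -- path, while the difference of the two deviations involves only `S` and the bound `N` under
    -- improvement.
    set ey := y u - (y s + V s u (y s)) with hey
    set ez := z u - (z s + V s u (z s)) with hez
    have eqy : ey = (∫ r in s..u, b (y r)) + stepError b V y s u := by
      rw [hey, stepError]; abel
    have eqz : ez = (∫ r in s..u, b (z r)) + stepError b V z s u := by
      rw [hez, stepError]; abel
    have ney : ‖ey‖ ≤ E * ω ^ 2 := by
      rw [eqy]
      calc _ ≤ B * |u - s| + M * modulus α s u ^ 3 := (norm_add_le _ _).trans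
            (add_le_add (norm_drift_integral_le hb y s u) (hyM s hs u hu))
        _ ≤ B * (Θ * ω ^ 2) + M * ω ^ 3 := by gcongr
        _ = (B * Θ + M * ω) * ω ^ 2 := by ring
        _ ≤ (B * Θ + M * Ω) * ω ^ 2 := by gcongr
        _ = _ := by rw [hE]
    have ned : ‖ey - ez‖ ≤ B * S * (Θ * ω ^ 2) + N * ω ^ 3 := by
      rw [eqy, eqz, add_sub_add_comm]
      refine (norm_add_le _ _).trans (add_le_add ((hdrift s hs u hu).trans ?_) d1')
      gcongr
    have nad : ‖(y s + V s u (y s)) - (z s + V s u (z s))‖ ≤ (1 + C * Ω) * S := by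
      rw [add_sub_add_comm]
      calc _ ≤ ‖y s - z s‖ + C * modulus α s u * ‖y s - z s‖ := (norm_add_le _ _).trans
            (add_le_add le_rfl (hV.lip s (sub hs) u (sub hu) _ _))
        _ ≤ S + C * Ω * S := by
            gcongr
            · exact hS s hs
            · exact m1.trans hωΩ
            · exact hS s hs
        _ = _ := by ring
    have hmix := hV.mixed (sub hu) (sub ht) (y s + V s u (y s)) (z s + V s u (z s)) ey ez
    have hdef := hV.defect_lip s (sub hs) u (sub hu) t (sub ht) ω m1 m2 (y s) (z s)
    rw [hadd y hy s hs u hu t ht, hadd z hz s hs u hu t ht]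
    calc _ = ‖(stepError b V y s u - stepError b V z s u)
          + (stepError b V y u t - stepError b V z u t)
          + (V u t ((y s + V s u (y s)) + ey) - V u t (y s + V s u (y s))
            - (V u t ((z s + V s u (z s)) + ez) - V u t (z s + V s u (z s))))
          + (driverDefect V s u t (y s) - driverDefect V s u t (z s))‖ := by
          congr 1; abel
      _ ≤ ‖stepError b V y s u - stepError b V z s u‖
          + ‖stepError b V y u t - stepError b V z u t‖
          + ‖V u t ((y s + V s u (y s)) + ey) - V u t (y s + V s u (y s))
            - (V u t ((z s + V s u (z s)) + ez) - V u t (z s + V s u (z s)))‖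
          + ‖driverDefect V s u t (y s) - driverDefect V s u t (z s)‖ := norm_add₄_le
      -- The new occurrence of `N` carries the factor `C * ω ≤ (1 - κ) / 2` and is absorbed into the
      -- contraction.
      _ ≤ N * (κ / 2 * ω ^ 3) + N * (κ / 2 * ω ^ 3)
          + C * ω * ((B * S * (Θ * ω ^ 2) + N * ω ^ 3) + (1 + C * Ω) * S * (E * ω ^ 2))
          + C * ω ^ 3 * S := by
          gcongr
          · refine hmix.trans ?_
            gcongr
          · refine hdef.trans ?_
            gcongr
            exact hS s hs
      _ = (κ * N + (C * ω) * N + Q) * ω ^ 3 := by rw [hQ]; ring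
      _ ≤ (κ * N + (1 - κ) / 2 * N + Q) * ω ^ 3 := by gcongr
      _ = ((1 + κ) / 2 * N + Q) * ω ^ 3 := by ring)
  refine (key s₀ hs₀ t₀ ht₀).trans (le_of_eq ?_)
  have : 1 - κ ≠ 0 := by linarith
  rw [show 1 - (1 + κ) / 2 = (1 - κ) / 2 by ring]
  field_simp

end IsRoughDriver

end Driver

/-! ### The flow of an equation with drift and rough driver -/

section Flow

variable {W : Type*} [NormedAddCommGroup W] {α T C B : ℝ}

lemma IsAlmostFlow.norm_sub_le_of_davieBound {μ : ℝ → ℝ → W → W} (h : IsAlmostFlow α T C μ)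
    (hα : 0 < α) {S : Set ℝ} (hS : S ⊆ Icc 0 T) {M : ℝ} (hM : 0 ≤ M) {y : ℝ → W}
    (hy : DavieBound α μ S M y) :
    ∀ s ∈ S, ∀ t ∈ S, ‖y t - y s‖ ≤ (M * (T ^ α) ^ 2 + C) * modulus α s t := by
  intro s hs t ht
  have h0 := modulus_nonneg α s t
  have h1 := modulus_le_rpow hα (hS hs) (hS ht)
  calc ‖y t - y s‖ ≤ ‖y t - μ s t (y s)‖ + ‖μ s t (y s) - y s‖ :=
        norm_sub_le_norm_sub_add_norm_sub _ _ _
    _ ≤ M * modulus α s t ^ 3 + C * modulus α s t :=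
        add_le_add (hy s hs t ht) (h.dist_id s (hS hs) t (hS ht) _)
    _ = (M * modulus α s t ^ 2 + C) * modulus α s t := by ring
    _ ≤ _ := by gcongr

/-- A local Lipschitz estimate for the difference of two paths yields a global one. -/
lemma exists_global_lipschitz_of_local (hα : 0 < α) {δ L : ℝ} (hδ : 0 < δ) (hL : 0 ≤ L)
    (hT : 0 ≤ T) : ∃ Λ : ℝ, 0 ≤ Λ ∧ ∀ a c, 0 ≤ a → c ≤ T → ∀ w : ℝ → W,
      (∀ s ∈ Icc a c, ∀ t ∈ Icc a c, |t - s| ≤ δ → ‖w t‖ ≤ (1 + L * modulus α s t) * ‖w s‖) →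
      ∀ s ∈ Icc a c, ∀ t ∈ Icc a c, ‖w t‖ ≤ Λ * ‖w s‖ := by
  obtain ⟨n, hn⟩ := exists_nat_gt (T / δ)
  have hTα : 0 ≤ T ^ α := Real.rpow_nonneg hT _
  have hn0 : (0 : ℝ) < n := lt_of_le_of_lt (by positivity) hn
  rw [div_lt_iff₀ hδ] at hn
  refine ⟨(1 + L * T ^ α) ^ n, by positivity, ?_⟩
  intro a c ha hc w hw s hs t ht
  have sub : Icc a c ⊆ Icc 0 T := Icc_subset_Icc ha hc
  have mem : ∀ k : ℕ, k ≤ n → s + (k : ℝ) / n * (t - s) ∈ Icc a c := fun k hk =>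
    IsAlmostFlow.segment_mem_Icc hs ht
      ⟨by positivity, by rw [div_le_one hn0]; exact_mod_cast hk⟩
  have key : ∀ k : ℕ, k ≤ n → ‖w (s + (k : ℝ) / n * (t - s))‖ ≤ (1 + L * T ^ α) ^ k * ‖w s‖ := by
    intro k
    induction k with
    | zero => intro _; simp
    | succ k ih =>
      intro hk
      have h1 := mem k (by omega)
      have h2 := mem (k + 1) hk
      have hlen : |s + ((k + 1 : ℕ) : ℝ) / n * (t - s) - (s + (k : ℝ) / n * (t - s))| ≤ δ := by
        have e : s + ((k + 1 : ℕ) : ℝ) / n * (t - s) - (s + (k : ℝ) / n * (t - s))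
            = (t - s) / n := by push_cast; ring
        rw [e, abs_div, abs_of_pos hn0, div_le_iff₀ hn0]
        have : |t - s| ≤ T := by simpa using abs_sub_le_of_mem_Icc (sub hs) (sub ht)
        linarith
      have h3 := hw _ h1 _ h2 hlen
      have h4 := modulus_le_rpow hα (sub h1) (sub h2)
      calc _ ≤ _ := h3
        _ ≤ (1 + L * T ^ α) * ((1 + L * T ^ α) ^ k * ‖w s‖) := by
          gcongr
          exact ih (by omega)
        _ = _ := by ring
  have := key n le_rfl
  rwa [div_self hn0.ne', one_mul, add_sub_cancel] at this

variable [NormedSpace ℝ W] {V : ℝ → ℝ → W → W} {b : W → W}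

/-- Davie error and step error differ only by the error of the one-step drift, which is of order `|t
- s|^(3α)` for Hölder paths. Bounds of that order can therefore be exchanged. -/
lemma stepError_eq (b : W → W) (V : ℝ → ℝ → W → W) (y : ℝ → W) (s t : ℝ) :
    stepError b V y s t = (y t - driftFlow b V s t (y s))
      - ((∫ r in s..t, b (y r)) - (t - s) • b (y s)) := by
  rw [stepError, driftFlow]; abel

/-- The one-step drift and the exact drift give the same expansion up to order
`|t - s| ^ (3 α)`. -/
lemma norm_drift_integral_sub_le_cube [CompleteSpace W] (hα : 0 < α) (hα' : α ≤ 1 / 2)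
    (hb : IsBoundedLipschitz B b) {a c : ℝ} (ha : 0 ≤ a) (hc : c ≤ T) {y : ℝ → W} {H : ℝ}
    (hH : 0 ≤ H) (hy : ∀ s ∈ Icc a c, ∀ t ∈ Icc a c, ‖y t - y s‖ ≤ H * modulus α s t) :
    ∀ s ∈ Icc a c, ∀ t ∈ Icc a c, ‖(∫ r in s..t, b (y r)) - (t - s) • b (y s)‖ ≤
      B * H * T ^ (1 - 2 * α) * modulus α s t ^ 3 := by
  intro s hs t ht
  have sub : Icc a c ⊆ Icc 0 T := Icc_subset_Icc ha hc
  have h1 := abs_sub_le_modulus_sq hα' (sub hs) (sub ht)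
  have h0 := modulus_nonneg α s t
  have hB := hb.nonneg
  calc _ ≤ B * H * modulus α s t * |t - s| :=
        IsRoughDriver.norm_drift_integral_sub_le hα hb hy hH hs ht
    _ ≤ B * H * modulus α s t * (T ^ (1 - 2 * α) * modulus α s t ^ 2) := by gcongr
    _ = _ := by ring

/-- Solutions depend on the initial value in a Lipschitz way, on short intervals with a Lipschitz
constant close to one. -/
theorem exists_local_lipschitz [CompleteSpace W] (hα : 1 / 3 < α) (hα' : α ≤ 1 / 2)
    (hT : 0 ≤ T) (hb : IsBoundedLipschitz B b) (hC : 0 ≤ C) :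
    ∃ δ L : ℝ, 0 < δ ∧ 0 < L ∧ ∀ V, IsRoughDriver α T C V → ∀ a c, 0 ≤ a → c ≤ T →
      ∀ y z : ℝ → W, (∃ M, DavieBound α (driftFlow b V) (Icc a c) M y) →
      (∃ M, DavieBound α (driftFlow b V) (Icc a c) M z) →
      ∀ s ∈ Icc a c, ∀ t ∈ Icc a c, |t - s| ≤ δ →
        ‖y t - z t‖ ≤ (1 + L * modulus α s t) * ‖y s - z s‖ := by
  have hα0 : 0 < α := by linarith
  have hκ0 := bisectFactor_nonneg α
  have hκ1 := bisectFactor_lt_one hα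
  obtain ⟨C', hC'⟩ := IsRoughDriver.exists_isAlmostFlow hα hα' hT hb C
  -- `C'` is known to be nonnegative only when some driver exists; otherwise the claim is vacuous.
  by_cases hne : ∃ V, IsRoughDriver (W := W) α T C V
  swap
  · exact ⟨1, 1, one_pos, one_pos, fun V hV => (hne ⟨V, hV⟩).elim⟩
  have hC'0 : 0 ≤ C' := by obtain ⟨V, hV⟩ := hne; exact (hC' V hV).nonneg
  have hB := hb.nonneg
  obtain ⟨Θ, hΘ⟩ : ∃ Θ, Θ = T ^ (1 - 2 * α) := ⟨_, rfl⟩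
  obtain ⟨Ω, hΩ⟩ : ∃ Ω, Ω = T ^ α := ⟨_, rfl⟩
  have hΘ0 : 0 ≤ Θ := hΘ ▸ Real.rpow_nonneg hT _
  have hΩ0 : 0 ≤ Ω := hΩ ▸ Real.rpow_nonneg hT _
  have hκ' : 0 < 1 - bisectFactor α := by linarith
  -- On short intervals, uniformly in the solutions: `M` is the Davie constant, `H` the Hölder
  -- constant and `M₁` the bound on step errors. `E` and `Q` belong to `stepError_sub_le`, and `P`
  -- is the Hölder constant of `y - z` relative to its supremum.
  obtain ⟨M, hM⟩ : ∃ M, M = 2 * C' / (1 - bisectFactor α) := ⟨_, rfl⟩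
  have hM0 : 0 ≤ M := by rw [hM]; positivity
  obtain ⟨H, hH⟩ : ∃ H, H = M * Ω ^ 2 + C' := ⟨_, rfl⟩
  have hH0 : 0 ≤ H := by rw [hH]; positivity
  obtain ⟨M₁, hM₁⟩ : ∃ M₁, M₁ = M + B * H * Θ := ⟨_, rfl⟩
  have hM₁0 : 0 ≤ M₁ := by rw [hM₁]; positivity
  obtain ⟨E, hE⟩ : ∃ E, E = B * Θ + M₁ * Ω := ⟨_, rfl⟩
  have hE0 : 0 ≤ E := by rw [hE]; positivity
  obtain ⟨Q, hQ⟩ : ∃ Q, Q = C * (B * Θ + (1 + C * Ω) * E) + C := ⟨_, rfl⟩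
  have hQ0 : 0 ≤ Q := by rw [hQ]; positivity
  obtain ⟨P, hP⟩ : ∃ P, P = B * Θ * Ω + C + 2 * Q / (1 - bisectFactor α) * Ω ^ 2 := ⟨_, rfl⟩
  have hP0 : 0 ≤ P := by rw [hP]; positivity
  obtain ⟨δ, hδ0, hδ⟩ := exists_rpow_small hα0 (C + C' + P)
    (ε := (1 - bisectFactor α) / 2) (by linarith)
  have hδα : 0 ≤ δ ^ α := Real.rpow_nonneg hδ0.le _
  have hδ1 : C * δ ^ α ≤ (1 - bisectFactor α) / 2 := by nlinarith
  have hδ2 : C' * δ ^ α ≤ (1 - bisectFactor α) / 2 := by nlinarith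
  have hδ3 : P * δ ^ α ≤ 1 / 2 := by nlinarith
  refine ⟨δ, 2 * P + 1, hδ0, by linarith, ?_⟩
  intro V hV a c ha hc y z hy hz s hs t ht hst
  obtain ⟨a', c', hac', hsub, hlen, hs', ht', hends⟩ : ∃ a' c', a' ≤ c' ∧
      Icc a' c' ⊆ Icc a c ∧ c' - a' ≤ δ ∧ s ∈ Icc a' c' ∧ t ∈ Icc a' c' ∧ c' - a' = |t - s| := by
    rcases le_total s t with h | h
    · rw [abs_of_nonneg (by linarith)] at hst ⊢
      exact ⟨s, t, h, Icc_subset_Icc hs.1 ht.2, hst, ⟨le_rfl, h⟩, ⟨h, le_rfl⟩, rfl⟩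
    · rw [abs_of_nonpos (by linarith)] at hst ⊢
      exact ⟨t, s, h, Icc_subset_Icc ht.1 hs.2, by linarith, ⟨h, le_rfl⟩, ⟨le_rfl, h⟩, by ring⟩
  have ha' : 0 ≤ a' := ha.trans (hsub ⟨le_rfl, hac'⟩).1
  have hc' : c' ≤ T := (hsub ⟨hac', le_rfl⟩).2.trans hc
  have sub : Icc a' c' ⊆ Icc 0 T := Icc_subset_Icc ha' hc'
  have prep : ∀ w : ℝ → W, (∃ M, DavieBound α (driftFlow b V) (Icc a c) M w) →
      ContinuousOn w (Icc a' c') ∧ ∀ s ∈ Icc a' c', ∀ t ∈ Icc a' c',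
        ‖stepError b V w s t‖ ≤ M₁ * modulus α s t ^ 3 := by
    rintro w ⟨Mw, hw⟩
    -- The arbitrary Davie constant `Mw` is replaced by the universal `M`, which makes `δ` and `L`
    -- independent of the solutions.
    have hwM := (hC' V hV).davieBound_of_exists hα hδ2 ha' hc' hlen ⟨Mw, hw.mono hsub le_rfl⟩
    rw [← hM] at hwM
    have hwH := (hC' V hV).norm_sub_le_of_davieBound hα0 sub hM0 hwM
    rw [← hΩ, ← hH] at hwH
    refine ⟨continuousOn_of_modulus_bound hα0 hwH, fun s hs t ht => ?_⟩
    have := norm_drift_integral_sub_le_cube hα0 hα' hb ha' hc' hH0 hwH s hs t ht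
    rw [← hΘ] at this
    rw [stepError_eq, hM₁, add_mul]
    exact (norm_sub_le _ _).trans (add_le_add (hwM s hs t ht) this)
  obtain ⟨hyc, hyE⟩ := prep y hy
  obtain ⟨hzc, hzE⟩ := prep z hz
  obtain ⟨r₀, hr₀, hmax⟩ := isCompact_Icc.exists_isMaxOn (nonempty_Icc.2 hac')
    ((hyc.sub hzc).norm)
  set S := ‖y r₀ - z r₀‖ with hS
  have hSle : ∀ r ∈ Icc a' c', ‖y r - z r‖ ≤ S := fun r hr => hmax hr
  have hS0 : 0 ≤ S := norm_nonneg _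
  have hD := hV.stepError_sub_le hα hα' hb hδ1 hΘ hΩ hE hM₁0 ha' hc' hlen hyc hzc hyE hzE hSle
  rw [← hQ] at hD
  have incr_le : ∀ r ∈ Icc a' c', ∀ q ∈ Icc a' c',
      ‖y q - z q - (y r - z r)‖ ≤ P * S * modulus α r q := by
    intro r hr q hq
    have h0 := modulus_nonneg α r q
    have hrq := modulus_le_rpow hα0 (sub hr) (sub hq)
    rw [← hΩ] at hrq
    have hab := abs_sub_le_modulus_sq hα' (sub hr) (sub hq)
    rw [← hΘ] at hab
    have hdrift : ‖(∫ x in r..q, b (y x)) - ∫ x in r..q, b (z x)‖ ≤ B * S * |q - r| := by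
      rw [← intervalIntegral.integral_sub (hb.intervalIntegrable hyc hr hq)
        (hb.intervalIntegrable hzc hr hq)]
      refine intervalIntegral.norm_integral_le_of_norm_le_const fun x hx => ?_
      refine (hb.lip _ _).trans ?_
      gcongr
      exact hSle x (uIcc_subset_Icc hr hq (uIoc_subset_uIcc hx))
    calc ‖y q - z q - (y r - z r)‖
        = ‖((∫ x in r..q, b (y x)) - ∫ x in r..q, b (z x)) + (V r q (y r) - V r q (z r))
          + (stepError b V y r q - stepError b V z r q)‖ := by
          congr 1; rw [stepError, stepError]; abel
      _ ≤ B * S * |q - r| + C * modulus α r q * ‖y r - z r‖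
          + 2 * (Q * S) / (1 - bisectFactor α) * modulus α r q ^ 3 :=
          norm_add₃_le.trans (add_le_add (add_le_add hdrift
            (hV.lip r (sub hr) q (sub hq) _ _)) (hD r hr q hq))
      _ ≤ B * S * (Θ * modulus α r q ^ 2) + C * modulus α r q * S
          + 2 * (Q * S) / (1 - bisectFactor α) * modulus α r q ^ 3 := by
          gcongr
          exact hSle r hr
      _ = (B * Θ * modulus α r q + C
          + 2 * Q / (1 - bisectFactor α) * modulus α r q ^ 2) * S * modulus α r q := by ring
      _ ≤ (B * Θ * Ω + C + 2 * Q / (1 - bisectFactor α) * Ω ^ 2) * S * modulus α r q := by gcongr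
      _ = _ := by rw [hP]
  -- Absorption at the point of maximum: `S ≤ ‖y s - z s‖ + S / 2` since `P * δ ^ α ≤ 1 / 2`.
  have hS2 : S ≤ 2 * ‖y s - z s‖ := by
    have h1 := incr_le s hs' r₀ hr₀
    have h2 : modulus α s r₀ ≤ δ ^ α :=
      modulus_le hα0 ((abs_sub_le_of_mem_Icc hs' hr₀).trans hlen)
    have h3 : P * S * modulus α s r₀ ≤ S / 2 := by
      calc P * S * modulus α s r₀ ≤ P * S * δ ^ α := by gcongr
        _ = (P * δ ^ α) * S := by ring
        _ ≤ 1 / 2 * S := by gcongr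
        _ = S / 2 := by ring
    have h4 := norm_sub_norm_le (y r₀ - z r₀) (y s - z s)
    linarith
  have h1 := incr_le s hs' t ht'
  have h2 := norm_sub_norm_le (y t - z t) (y s - z s)
  have h0 := modulus_nonneg α s t
  calc ‖y t - z t‖ ≤ ‖y s - z s‖ + P * S * modulus α s t := by linarith
    _ ≤ ‖y s - z s‖ + P * (2 * ‖y s - z s‖) * modulus α s t := by gcongr
    _ = (1 + 2 * P * modulus α s t) * ‖y s - z s‖ := by ring
    _ ≤ _ := by gcongr; linarith

/-- Davie solutions of an equation with drift and rough driver are unique and form a flow. -/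
theorem exists_davie_flow [ProperSpace W] (hα : 1 / 3 < α) (hα' : α ≤ 1 / 2)
    (hT : 0 ≤ T) (hb : IsBoundedLipschitz B b) (hC : 0 ≤ C) :
    ∃ δ L : ℝ, 0 < δ ∧ 0 < L ∧ ∀ V, IsRoughDriver α T C V →
      (∀ a c, 0 ≤ a → c ≤ T → ∀ y z : ℝ → W,
        (∃ M, DavieBound α (driftFlow b V) (Icc a c) M y) →
        (∃ M, DavieBound α (driftFlow b V) (Icc a c) M z) →
        ∀ s ∈ Icc a c, y s = z s → EqOn y z (Icc a c)) ∧
      ∃ φ : ℝ → ℝ → W → W, IsContinuousFlow (Icc 0 T) φ ∧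
        (∀ s ∈ Icc 0 T, ∀ ζ, ∃ M, 0 ≤ M ∧
          DavieBound α (driftFlow b V) (Icc 0 T) M (fun t => φ s t ζ)) ∧
        ∀ s ∈ Icc 0 T, ∀ t ∈ Icc 0 T, |t - s| ≤ δ → ∀ ζ₁ ζ₂,
          ‖φ s t ζ₁ - φ s t ζ₂‖ ≤ (1 + L * modulus α s t) * ‖ζ₁ - ζ₂‖ := by
  have hα0 : 0 < α := by linarith
  obtain ⟨δ, L, hδ, hL, hlip⟩ := exists_local_lipschitz hα hα' hT hb hC
  obtain ⟨Λ, hΛ0, hΛ⟩ := exists_global_lipschitz_of_local (W := W) hα0 hδ hL.le hT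
  obtain ⟨C', hC'⟩ := IsRoughDriver.exists_isAlmostFlow hα hα' hT hb C
  refine ⟨δ, L, hδ, hL, fun V hV => ?_⟩
  have glob : ∀ a c, 0 ≤ a → c ≤ T → ∀ y z : ℝ → W,
      (∃ M, DavieBound α (driftFlow b V) (Icc a c) M y) →
      (∃ M, DavieBound α (driftFlow b V) (Icc a c) M z) →
      ∀ s ∈ Icc a c, ∀ t ∈ Icc a c, ‖y t - z t‖ ≤ Λ * ‖y s - z s‖ :=
    fun a c ha hc y z hy hz => hΛ a c ha hc (fun t => y t - z t) (hlip V hV a c ha hc y z hy hz)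
  have uniq : ∀ a c, 0 ≤ a → c ≤ T → ∀ y z : ℝ → W,
      (∃ M, DavieBound α (driftFlow b V) (Icc a c) M y) →
      (∃ M, DavieBound α (driftFlow b V) (Icc a c) M z) →
      ∀ s ∈ Icc a c, y s = z s → EqOn y z (Icc a c) := by
    intro a c ha hc y z hy hz s hs hsz t ht
    have := glob a c ha hc y z hy hz s hs t ht
    rw [hsz, sub_self, norm_zero, mul_zero] at this
    exact sub_eq_zero.1 (norm_le_zero_iff.1 this)
  have hex : ∀ s, ∀ ζ : W, ∃ y : ℝ → W, s ∈ Icc 0 T → y s = ζ ∧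
      ∃ M, DavieBound α (driftFlow b V) (Icc 0 T) M y := by
    intro s ζ
    by_cases hs : s ∈ Icc 0 T
    · obtain ⟨y, hy⟩ := (hC' V hV).exists_davie hα hs ζ
      exact ⟨y, fun _ => hy⟩
    · exact ⟨fun _ => ζ, fun h => (hs h).elim⟩
  choose y hy using hex
  -- Both paths are Davie solutions on all of `[0, T]` agreeing at `u`. Uniqueness acts on both
  -- sides of `u`, so the order of the times is irrelevant.
  have hcomp : ∀ s ∈ Icc 0 T, ∀ u ∈ Icc 0 T, ∀ t ∈ Icc 0 T, ∀ ζ, y u (y s ζ u) t = y s ζ t := by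
    intro s hs u hu t ht ζ
    exact uniq 0 T le_rfl le_rfl _ _ (hy u _ hu).2 (hy s ζ hs).2 u hu (hy u _ hu).1 ht
  have hpath : ∀ s ∈ Icc 0 T, ∀ ζ, ∃ M, 0 ≤ M ∧
      DavieBound α (driftFlow b V) (Icc 0 T) M (y s ζ) := by
    intro s hs ζ
    obtain ⟨M, hM⟩ := (hy s ζ hs).2
    exact ⟨|M|, abs_nonneg M, hM.mono subset_rfl (le_abs_self M)⟩
  have hycont : ∀ s ∈ Icc 0 T, ∀ ζ, ContinuousOn (y s ζ) (Icc 0 T) := by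
    intro s hs ζ
    obtain ⟨M, hM0, hM⟩ := hpath s hs ζ
    exact continuousOn_of_modulus_bound hα0
      ((hC' V hV).norm_sub_le_of_davieBound hα0 subset_rfl hM0 hM)
  refine ⟨uniq, fun s t ζ => y s ζ t, ⟨fun t ht ζ => (hy t ζ ht).1, hcomp, ?_⟩, hpath, ?_⟩
  · rintro ⟨s, t, ζ⟩ ⟨hs, ht, -⟩
    rw [ContinuousWithinAt, tendsto_iff_norm_sub_tendsto_zero]
    set F := 𝓝[Icc 0 T ×ˢ Icc 0 T ×ˢ univ] ((s, t, ζ) : ℝ × ℝ × W) with hF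
    have hFm : ∀ᶠ q in F, q.1 ∈ Icc 0 T ∧ q.2.1 ∈ Icc 0 T := by
      filter_upwards [self_mem_nhdsWithin] with q hq using ⟨hq.1, hq.2.1⟩
    have l1 : Tendsto (fun q : ℝ × ℝ × W => q.1) F (𝓝[Icc 0 T] s) :=
      tendsto_nhdsWithin_iff.2 ⟨(continuous_fst.tendsto _).mono_left nhdsWithin_le_nhds,
        hFm.mono fun q hq => hq.1⟩
    have l2 : Tendsto (fun q : ℝ × ℝ × W => q.2.1) F (𝓝[Icc 0 T] t) :=
      tendsto_nhdsWithin_iff.2 ⟨((continuous_fst.comp continuous_snd).tendsto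
        ((s, t, ζ) : ℝ × ℝ × W)).mono_left nhdsWithin_le_nhds, hFm.mono fun q hq => hq.2⟩
    have l3 : Tendsto (fun q : ℝ × ℝ × W => q.2.2) F (𝓝 ζ) :=
      ((continuous_snd.comp continuous_snd).tendsto
        ((s, t, ζ) : ℝ × ℝ × W)).mono_left nhdsWithin_le_nhds
    have t1 : Tendsto (fun q : ℝ × ℝ × W => y s ζ q.1) F (𝓝 ζ) := by
      have := (hycont s hs ζ s hs).tendsto.comp l1
      rwa [(hy s ζ hs).1] at this
    have t2 : Tendsto (fun q : ℝ × ℝ × W => y s ζ q.2.1) F (𝓝 (y s ζ t)) :=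
      (hycont s hs ζ t ht).tendsto.comp l2
    -- The solution started at a nearby time and value is compared with the fixed path `y s ζ` at
    -- that starting time. The global Lipschitz constant carries the comparison to the evaluation
    -- time.
    have t3 : Tendsto (fun q : ℝ × ℝ × W => Λ * ‖q.2.2 - y s ζ q.1‖ + ‖y s ζ q.2.1 - y s ζ t‖)
        F (𝓝 0) := by
      have h1 := ((l3.sub t1).norm).const_mul Λ
      have h2 := (tendsto_iff_norm_sub_tendsto_zero.1 t2)
      simpa using h1.add h2
    refine squeeze_zero' (Eventually.of_forall fun _ => norm_nonneg _) ?_ t3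
    filter_upwards [hFm] with q hq
    refine (norm_sub_le_norm_sub_add_norm_sub _ (y s ζ q.2.1) _).trans ?_
    gcongr
    have h1 := glob 0 T le_rfl le_rfl _ _ (hy q.1 q.2.2 hq.1).2 (hy s ζ hs).2 q.1 hq.1 q.2.1 hq.2
    rwa [(hy q.1 q.2.2 hq.1).1] at h1
  · intro s hs t ht hst ζ₁ ζ₂
    have := hlip V hV 0 T le_rfl le_rfl _ _ (hy s ζ₁ hs).2 (hy s ζ₂ hs).2 s hs t ht hst
    rwa [(hy s ζ₁ hs).1, (hy s ζ₂ hs).1] at this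

end Flow

/-! ### Functions with Lipschitz derivative -/

section Regularity

variable {W Z : Type*} [NormedAddCommGroup W] [NormedAddCommGroup Z]

/-- A bounded Lipschitz function with bounded second-order difference quotients. -/
structure IsBoundedRect (A : ℝ) (f : W → Z) : Prop where
  nonneg : 0 ≤ A
  norm_le : ∀ z, ‖f z‖ ≤ A
  lip : ∀ z w, ‖f z - f w‖ ≤ A * ‖z - w‖
  rect : ∀ a c k, ‖f (a + k) - f a - (f (c + k) - f c)‖ ≤ A * (‖a - c‖ * ‖k‖)

lemma IsBoundedRect.mixed {A : ℝ} {f : W → Z} (hf : IsBoundedRect A f) (a c k l : W) :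
    ‖f (a + k) - f a - (f (c + l) - f c)‖ ≤ A * (‖k - l‖ + ‖a - c‖ * ‖k‖) := by
  have h1 := hf.rect a c k
  have h2 := hf.lip (c + k) (c + l)
  rw [add_sub_add_left_eq_sub] at h2
  calc _ = ‖(f (a + k) - f a - (f (c + k) - f c)) + (f (c + k) - f (c + l))‖ := by congr 1; abel
    _ ≤ _ := norm_add_le _ _
    _ ≤ _ := by linarith

variable [NormedSpace ℝ Z]

/-- Product rule for second differences: four terms, with both differences on `f`, both on `g`, or
one on each in two ways. This gives the regularity of `Dσ · σ`. -/
lemma IsBoundedRect.bilinear {Z₁ Z₂ : Type*} [NormedAddCommGroup Z₁] [NormedSpace ℝ Z₁]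
    [NormedAddCommGroup Z₂] [NormedSpace ℝ Z₂] {A B : ℝ} {f : W → Z₁} {g : W → Z₂}
    (hf : IsBoundedRect A f) (hg : IsBoundedRect B g) (T : Z₁ →L[ℝ] Z₂ →L[ℝ] Z) :
    IsBoundedRect (‖T‖ * (4 * (A * B))) (fun ξ => T (f ξ) (g ξ)) := by
  have hA := hf.nonneg
  have hB := hg.nonneg
  have hT : ∀ x y p q, ‖x‖ ≤ p → ‖y‖ ≤ q → ‖T x y‖ ≤ ‖T‖ * (p * q) := by
    intro x y p q hx hy
    have : 0 ≤ p := (norm_nonneg _).trans hx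
    rw [← mul_assoc]
    exact (T.le_opNorm₂ x y).trans (by gcongr)
  refine ⟨by positivity, ?_, ?_, ?_⟩
  · intro z
    refine (hT _ _ _ _ (hf.norm_le z) (hg.norm_le z)).trans ?_
    exact mul_le_mul_of_nonneg_left (by linarith [mul_nonneg hA hB]) (norm_nonneg T)
  · intro z w
    have h1 := hT _ _ _ _ (hf.lip z w) (hg.norm_le z)
    have h2 := hT _ _ _ _ (hf.norm_le w) (hg.lip z w)
    have h3 : 0 ≤ ‖T‖ * (A * B) * ‖z - w‖ := by positivity
    calc _ = ‖T (f z - f w) (g z) + T (f w) (g z - g w)‖ := by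
          congr 1; simp only [map_sub, sub_apply]; abel
      _ ≤ _ := norm_add_le _ _
      _ ≤ _ := by linarith
  · intro a c k
    have lip' : ∀ p q : W, ‖f (p + q) - f p‖ ≤ A * ‖q‖ ∧ ‖g (p + q) - g p‖ ≤ B * ‖q‖ := by
      intro p q
      have h1 := hf.lip (p + q) p
      have h2 := hg.lip (p + q) p
      rw [add_sub_cancel_left] at h1 h2
      exact ⟨h1, h2⟩
    have h1 := hT _ _ _ _ (hf.rect a c k) (hg.norm_le (a + k))
    have hgk := hg.lip (a + k) (c + k)
    rw [add_sub_add_right_eq_sub] at hgk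
    have h2 := hT _ _ _ _ (lip' c k).1 hgk
    have h3 := hT _ _ _ _ (hf.lip a c) (lip' a k).2
    have h4 := hT _ _ _ _ (hf.norm_le c) (hg.rect a c k)
    calc _ = ‖T (f (a + k) - f a - (f (c + k) - f c)) (g (a + k))
          + T (f (c + k) - f c) (g (a + k) - g (c + k)) + T (f a - f c) (g (a + k) - g a)
          + T (f c) (g (a + k) - g a - (g (c + k) - g c))‖ := by
          congr 1; simp only [map_sub, sub_apply]; abel
      _ ≤ _ := norm_add₄_le
      _ ≤ _ := by linarith

lemma IsBoundedRect.clm_comp {Z' : Type*} [NormedAddCommGroup Z'] [NormedSpace ℝ Z'] {A : ℝ}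
    {f : W → Z} (hf : IsBoundedRect A f) (T : Z →L[ℝ] Z') :
    IsBoundedRect (‖T‖ * A) (fun ξ => T (f ξ)) := by
  have := hf.nonneg
  refine ⟨by positivity, fun z => ?_, fun z w => ?_, fun a c k => ?_⟩
  · exact (T.le_opNorm _).trans (by gcongr; exact hf.norm_le z)
  · rw [← map_sub, mul_assoc]
    exact (T.le_opNorm _).trans (by gcongr; exact hf.lip z w)
  · rw [← map_sub, ← map_sub, ← map_sub, mul_assoc]
    exact (T.le_opNorm _).trans (by gcongr; exact hf.rect a c k)

variable [NormedSpace ℝ W]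

lemma IsCkb.succ {k : ℕ} {f : W → Z} (hf : IsCkb (k + 1) f) :
    Differentiable ℝ f ∧ (∃ M, ∀ z, ‖f z‖ ≤ M) ∧ IsCkb k (fderiv ℝ f) := by
  refine ⟨?_, ?_, ?_, ?_⟩
  · have := hf.1 0 (by omega)
    rwa [iteratedFDeriv_zero_eq_comp, LinearIsometryEquiv.comp_differentiable_iff] at this
  · obtain ⟨M, hM⟩ := hf.2 0 (by omega)
    exact ⟨M, fun z => by simpa using hM z⟩
  · intro i hi
    have := hf.1 (i + 1) (by omega)
    rw [funext fun x => iteratedFDeriv_succ_eq_comp_right (𝕜 := ℝ) (f := f) (x := x) (n := i)]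
      at this
    exact (continuousMultilinearCurryRightEquiv' ℝ i W Z).symm.comp_differentiable_iff.1 this
  · intro i hi
    obtain ⟨M, hM⟩ := hf.2 (i + 1) (by omega)
    exact ⟨M, fun z => by rw [norm_iteratedFDeriv_fderiv]; exact hM z⟩

lemma IsCkb.mono {k l : ℕ} (hkl : l ≤ k) {f : W → Z} (hf : IsCkb k f) : IsCkb l f :=
  ⟨fun i hi => hf.1 i (by omega), fun i hi => hf.2 i (by omega)⟩

lemma IsCkb.exists_norm_le {k : ℕ} {f : W → Z} (hf : IsCkb k f) : ∃ M, ∀ z, ‖f z‖ ≤ M := by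
  obtain ⟨M, hM⟩ := hf.2 0 (Nat.zero_le _)
  exact ⟨M, fun z => by simpa using hM z⟩

lemma norm_sub_le_of_fderiv_bound {f : W → Z} (hf : Differentiable ℝ f) {M : ℝ}
    (hM : ∀ z, ‖fderiv ℝ f z‖ ≤ M) (z w : W) : ‖f z - f w‖ ≤ M * ‖z - w‖ :=
  convex_univ.norm_image_sub_le_of_norm_fderiv_le (fun x _ => hf x) (fun x _ => hM x)
    (mem_univ w) (mem_univ z)

/-- For the second differences, the mean value inequality is applied to `k ↦ f (a + k) - f (c + k)`,
whose derivative is bounded by `M₂ ‖a - c‖`. -/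
lemma IsCkb.exists_isBoundedRect {f : W → Z} (hf : IsCkb 2 f) : ∃ A, IsBoundedRect A f := by
  obtain ⟨hd, ⟨M₀, hM₀⟩, hf'⟩ := hf.succ
  obtain ⟨hd', ⟨M₁, hM₁⟩, hf''⟩ := hf'.succ
  obtain ⟨M₂, hM₂⟩ := hf''.exists_norm_le
  have p0 : 0 ≤ M₀ := (norm_nonneg _).trans (hM₀ 0)
  have p1 : 0 ≤ M₁ := (norm_nonneg _).trans (hM₁ 0)
  have p2 : 0 ≤ M₂ := (norm_nonneg _).trans (hM₂ 0)
  refine ⟨M₀ + M₁ + M₂, by positivity, fun z => (hM₀ z).trans (by linarith), fun z w => ?_,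
    fun a c k => ?_⟩
  · exact (norm_sub_le_of_fderiv_bound hd hM₁ z w).trans (by gcongr; linarith)
  · have hder : ∀ k, HasFDerivAt (fun k => f (a + k) - f (c + k))
        (fderiv ℝ f (a + k) - fderiv ℝ f (c + k)) k := fun k =>
      ((hasFDerivAt_comp_add_left a).2 (hd (a + k)).hasFDerivAt).sub
        ((hasFDerivAt_comp_add_left c).2 (hd (c + k)).hasFDerivAt)
    have := convex_univ.norm_image_sub_le_of_norm_hasFDerivWithin_le
      (f := fun k => f (a + k) - f (c + k)) (C := M₂ * ‖a - c‖)
      (fun k _ => (hder k).hasFDerivWithinAt) (fun k _ => by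
        have := norm_sub_le_of_fderiv_bound hd' hM₂ (a + k) (c + k)
        rwa [add_sub_add_right_eq_sub] at this) (mem_univ (0 : W)) (mem_univ k)
    simp only [add_zero, sub_zero] at this
    calc _ = ‖f (a + k) - f (c + k) - (f a - f c)‖ := by congr 1; abel
      _ ≤ _ := this
      _ = M₂ * (‖a - c‖ * ‖k‖) := by ring
      _ ≤ _ := by gcongr; linarith

/-- The remainder of the first-order Taylor expansion. -/
noncomputable def taylorRemainder (f : W → Z) (ξ w : W) : Z := f (ξ + w) - f ξ - fderiv ℝ f ξ w

lemma hasFDerivAt_taylorRemainder {f : W → Z} (hf : Differentiable ℝ f) (ξ w : W) :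
    HasFDerivAt (taylorRemainder f ξ) (fderiv ℝ f (ξ + w) - fderiv ℝ f ξ) w :=
  (((hasFDerivAt_comp_add_left ξ).2 (hf (ξ + w)).hasFDerivAt).sub_const (f ξ)).sub (fderiv ℝ f ξ).hasFDerivAt

lemma taylorRemainder_zero (f : W → Z) (ξ : W) : taylorRemainder f ξ 0 = 0 := by
  simp [taylorRemainder]

/-- The remainder has derivative `Df(ξ + v) - Df(ξ)` in the increment `v`, bounded by `A ‖v‖`; the
ball of radius `‖w‖ + ‖w'‖` contains both increments. -/
lemma norm_taylorRemainder_sub_le_right {f : W → Z} (hf : Differentiable ℝ f) {A : ℝ}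
    (hA : IsBoundedRect A (fderiv ℝ f)) (ξ w w' : W) :
    ‖taylorRemainder f ξ w - taylorRemainder f ξ w'‖ ≤ A * (‖w‖ + ‖w'‖) * ‖w - w'‖ := by
  refine (convex_closedBall (0 : W) (‖w‖ + ‖w'‖)).norm_image_sub_le_of_norm_hasFDerivWithin_le
    (fun v _ => (hasFDerivAt_taylorRemainder hf ξ v).hasFDerivWithinAt) (fun v hv => ?_) ?_ ?_
  · have := hA.lip (ξ + v) ξ
    rw [add_sub_cancel_left] at this
    have := hA.nonneg
    exact (hA.lip (ξ + v) ξ).trans (by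
      rw [add_sub_cancel_left]; gcongr; exact mem_closedBall_zero_iff.1 hv)
  · rw [mem_closedBall_zero_iff]; linarith [norm_nonneg w]
  · rw [mem_closedBall_zero_iff]; linarith [norm_nonneg w']

lemma norm_taylorRemainder_le {f : W → Z} (hf : Differentiable ℝ f) {A : ℝ}
    (hA : IsBoundedRect A (fderiv ℝ f)) (ξ w : W) :
    ‖taylorRemainder f ξ w‖ ≤ A * ‖w‖ ^ 2 := by
  have := norm_taylorRemainder_sub_le_right hf hA ξ w 0
  rw [taylorRemainder_zero, norm_zero, sub_zero, sub_zero, add_zero] at this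
  linarith

/-- The derivative in the increment is a second difference of `Df`. For `f = σ` this is where the
third derivative is needed. -/
lemma norm_taylorRemainder_sub_le_left {f : W → Z} (hf : Differentiable ℝ f) {A : ℝ}
    (hA : IsBoundedRect A (fderiv ℝ f)) (ξ ζ w : W) :
    ‖taylorRemainder f ξ w - taylorRemainder f ζ w‖ ≤ A * ‖w‖ ^ 2 * ‖ξ - ζ‖ := by
  have := (convex_closedBall (0 : W) ‖w‖).norm_image_sub_le_of_norm_hasFDerivWithin_le
    (f := fun v => taylorRemainder f ξ v - taylorRemainder f ζ v) (C := A * (‖ξ - ζ‖ * ‖w‖))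
    (fun v _ => ((hasFDerivAt_taylorRemainder hf ξ v).sub
      (hasFDerivAt_taylorRemainder hf ζ v)).hasFDerivWithinAt) (fun v hv => by
      have := hA.nonneg
      exact (hA.rect ξ ζ v).trans (by gcongr; exact mem_closedBall_zero_iff.1 hv))
    (x := 0) (y := w) (by simp) (by simp)
  simp only [taylorRemainder_zero, sub_zero] at this
  refine this.trans (le_of_eq (by ring))

end Regularity

/-! ### Bounds for rough paths -/

section RoughBounds

variable {E : Type*} [NormedAddCommGroup E] [InnerProductSpace ℝ E]
variable {V : Type*} [NormedAddCommGroup V]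

lemma norm_le_of_holderSeminorm_le {α a b : ℝ} {F : ℝ → ℝ → V} {c : ℝ≥0}
    (h : holderSeminorm α a b F ≤ c) {s t : ℝ} (hs : s ∈ Icc a b) (ht : t ∈ Icc a b)
    (hst : s < t) : ‖F s t‖ ≤ c * |t - s| ^ α := by
  have h1 : ENNReal.ofReal (‖F s t‖ / |t - s| ^ α) ≤ c := by
    refine le_trans ?_ h
    unfold holderSeminorm
    exact le_iSup₂_of_le s hs (le_iSup₂_of_le t ht (le_iSup_of_le hst le_rfl))
  have hpos : 0 < |t - s| ^ α := Real.rpow_pos_of_pos (abs_pos.2 (by linarith)) _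
  rw [ENNReal.ofReal_le_coe, div_le_iff₀ hpos] at h1
  exact h1

lemma holderSeminorm_lt_top {α a b : ℝ} {F : ℝ → ℝ → V} {c : ℝ}
    (h : ∀ s ∈ Icc a b, ∀ t ∈ Icc a b, s < t → ‖F s t‖ ≤ c * |t - s| ^ α) :
    holderSeminorm α a b F < ∞ := by
  refine lt_of_le_of_lt ?_ (ENNReal.ofReal_lt_top (r := c))
  unfold holderSeminorm
  refine iSup₂_le fun s hs => iSup₂_le fun t ht => iSup_le fun hst => ?_
  have hpos : 0 < |t - s| ^ α := Real.rpow_pos_of_pos (abs_pos.2 (by linarith)) _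
  exact ENNReal.ofReal_le_ofReal ((div_le_iff₀ hpos).2 (h s hs t ht hst))

lemma exists_norm_le_of_holderSeminorm_lt_top {α a b : ℝ} {F : ℝ → ℝ → V}
    (h : holderSeminorm α a b F < ∞) : ∃ c : ℝ, 0 ≤ c ∧ ∀ s ∈ Icc a b, ∀ t ∈ Icc a b, s < t →
      ‖F s t‖ ≤ c * |t - s| ^ α := by
  refine ⟨(holderSeminorm α a b F).toNNReal, NNReal.coe_nonneg _, fun s hs t ht hst => ?_⟩
  exact norm_le_of_holderSeminorm_le (ENNReal.coe_toNNReal h.ne).ge hs ht hst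

lemma incr_swap (x : ℝ → V) (s t : ℝ) : incr x t s = -incr x s t := by simp [incr]

namespace IsRoughPath

variable {p T : ℝ} {x : ℝ → E} {X : ℝ → ℝ → E ⊗[ℝ] E}

lemma self_eq_zero (h : IsRoughPath p T x X) {s : ℝ} (hs : s ∈ Icc 0 T) : X s s = 0 := by
  have := h.chen s hs s hs s hs
  simpa [incr] using this

/-- Chen's relation on a step forth and back. It transfers bounds to decreasing times, which the
Hölder seminorms do not see. -/
lemma swap (h : IsRoughPath p T x X) {s t : ℝ} (hs : s ∈ Icc 0 T) (ht : t ∈ Icc 0 T) :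
    X t s = incr x s t ⊗ₜ[ℝ] incr x s t - X s t := by
  have := h.chen s hs t ht s hs
  rw [h.self_eq_zero hs, incr_swap x s t, TensorProduct.tmul_neg] at this
  calc X t s = -(0 - X s t - X t s) - X s t := by abel
    _ = _ := by rw [this, neg_neg]

/-- The bounds on a rough path, for time steps in either direction. -/
lemma norm_le (h : IsRoughPath p T x X) (hp : 0 < p) {c : ℝ≥0} (hc : roughNorm p T x X ≤ c)
    {s t : ℝ} (hs : s ∈ Icc 0 T) (ht : t ∈ Icc 0 T) :
    ‖incr x s t‖ ≤ (c + 2 * c ^ 2) * modulus (1 / p) s t ∧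
      ‖X s t‖ ≤ (c + 2 * c ^ 2) * modulus (1 / p) s t ^ 2 := by
  have hα : 0 < 1 / p := by positivity
  have hx : holderSeminorm (1 / p) 0 T (incr x) ≤ c := le_self_add.trans hc
  -- The norm contains the square root of the second-level seminorm, hence `c ^ 2`. Backward steps
  -- add another `c ^ 2` through the tensor square, whence `c + 2 * c ^ 2`.
  have hX : holderSeminorm (2 / p) 0 T X ≤ (c ^ 2 : ℝ≥0) := by
    have : (holderSeminorm (2 / p) 0 T X) ^ (1 / 2 : ℝ) ≤ c := le_add_self.trans hc
    rw [one_div, ENNReal.rpow_inv_le_iff two_pos, ENNReal.rpow_two] at this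
    exact_mod_cast this
  have hm : ∀ s t : ℝ, |t - s| ^ (2 / p) = modulus (1 / p) s t ^ 2 := fun s t => by
    rw [modulus_pow_eq]; congr 1; push_cast; ring
  have key : ∀ s ∈ Icc 0 T, ∀ t ∈ Icc 0 T, s < t →
      ‖incr x s t‖ ≤ c * modulus (1 / p) s t ∧ ‖X s t‖ ≤ c ^ 2 * modulus (1 / p) s t ^ 2 := by
    intro s hs t ht hst
    refine ⟨norm_le_of_holderSeminorm_le hx hs ht hst, ?_⟩
    have := norm_le_of_holderSeminorm_le hX hs ht hst
    rw [hm] at this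
    simpa using this
  have hc0 : (0 : ℝ) ≤ c := c.2
  have hω := modulus_nonneg (1 / p) s t
  rcases lt_trichotomy s t with hst | rfl | hst
  · obtain ⟨h1, h2⟩ := key s hs t ht hst
    have : 0 ≤ (c : ℝ) * modulus (1 / p) s t ^ 2 := by positivity
    have : 0 ≤ (c : ℝ) ^ 2 * modulus (1 / p) s t ^ 2 := by positivity
    have : 0 ≤ (c : ℝ) ^ 2 * modulus (1 / p) s t := by positivity
    constructor <;> nlinarith
  · rw [modulus_self hα, h.self_eq_zero hs]; simp [incr]
  · obtain ⟨h1, h2⟩ := key t ht s hs hst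
    rw [incr_swap, norm_neg, h.swap ht hs, modulus_comm]
    rw [modulus_comm] at hω
    have h3 : ‖incr x t s ⊗ₜ[ℝ] incr x t s - X t s‖ ≤
        ‖incr x t s‖ * ‖incr x t s‖ + ‖X t s‖ := by
      rw [← TensorProduct.norm_tmul (𝕜 := ℝ)]; exact norm_sub_le _ _
    have h4 : ‖incr x t s‖ * ‖incr x t s‖ ≤
        (c * modulus (1 / p) t s) * (c * modulus (1 / p) t s) := by
      gcongr
    have : 0 ≤ (c : ℝ) * modulus (1 / p) t s ^ 2 := by positivity
    have : 0 ≤ (c : ℝ) ^ 2 * modulus (1 / p) t s := by positivity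
    constructor <;> nlinarith

end IsRoughPath

end RoughBounds

/-! ### The rough driver of a rough path and a vector field of class `C^3_b` -/

section RoughField

variable {E : Type*} [NormedAddCommGroup E] [InnerProductSpace ℝ E]
variable {W : Type*} [NormedAddCommGroup W] [NormedSpace ℝ W]

/-- The second-order increment `σ(ξ) x_{s,t} + Dσ(ξ) σ(ξ) 𝕏_{s,t}`. -/
noncomputable def roughField (σ : W → E →L[ℝ] W) (x : ℝ → E) (X : ℝ → ℝ → E ⊗[ℝ] E)
    (s t : ℝ) (ξ : W) : W :=
  σ ξ (incr x s t) + applyTensor ((fderiv ℝ σ ξ).comp (σ ξ)) (X s t)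

lemma applyTensor_tmul (A : E →L[ℝ] E →L[ℝ] W) (v w : E) :
    applyTensor A (v ⊗ₜ[ℝ] w) = A v w := by
  simp [applyTensor]

/-- Finite dimension makes the passage from bilinear maps to linear maps on tensors continuous, so
it preserves `IsBoundedRect`. -/
lemma exists_applyTensor_clm [FiniteDimensional ℝ E] [FiniteDimensional ℝ W] :
    ∃ T : (E →L[ℝ] E →L[ℝ] W) →L[ℝ] (E ⊗[ℝ] E →L[ℝ] W), ∀ A z, T A z = applyTensor A z := by
  let T : (E →L[ℝ] E →L[ℝ] W) →ₗ[ℝ] (E ⊗[ℝ] E →L[ℝ] W) :=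
    { toFun := fun A => LinearMap.toContinuousLinearMap (applyTensor A)
      map_add' := fun A B => by
        ext z
        induction z with
        | zero => simp
        | tmul v w => simp [applyTensor_tmul]
        | add a b ha hb => rw [map_add, map_add, ha, hb]
      map_smul' := fun c A => by
        ext z
        induction z with
        | zero => simp
        | tmul v w => simp [applyTensor_tmul]
        | add a b ha hb => rw [map_add, map_add, ha, hb] }
  exact ⟨LinearMap.toContinuousLinearMap T, fun A z => rfl⟩

/-- By Chen's relation `X s t = X 0 t - X 0 s - x_{0,s} ⊗ x_{s,t}`, which reduces joint continuity
to continuity of paths in one variable. -/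
lemma IsRoughPath.continuousOn_snd {p T : ℝ} (hp : 0 < p) {x : ℝ → E} {X : ℝ → ℝ → E ⊗[ℝ] E}
    (h : IsRoughPath p T x X) {R : ℝ}
    (hx : ∀ s ∈ Icc 0 T, ∀ t ∈ Icc 0 T, ‖incr x s t‖ ≤ R * modulus (1 / p) s t)
    (hX : ∀ s ∈ Icc 0 T, ∀ t ∈ Icc 0 T, ‖X s t‖ ≤ R * modulus (1 / p) s t ^ 2) :
    ContinuousOn (fun q : ℝ × ℝ => X q.1 q.2) (Icc 0 T ×ˢ Icc 0 T) := by
  have hα : 0 < 1 / p := by positivity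
  rcases lt_or_ge T 0 with hT | hT
  · simp [Icc_eq_empty (not_le.2 hT)]
  have h0 : (0 : ℝ) ∈ Icc 0 T := ⟨le_rfl, hT⟩
  have hxc : ContinuousOn x (Icc 0 T) := continuousOn_of_modulus_bound hα hx
  have hX0 : ContinuousOn (X 0) (Icc 0 T) := by
    refine continuousOn_of_modulus_bound (H := R * T ^ (1 / p) + R * T ^ (1 / p) * R) hα ?_
    intro s hs t ht
    have e : X 0 t - X 0 s = X s t + incr x 0 s ⊗ₜ[ℝ] incr x s t := by
      rw [← h.chen 0 h0 s hs t ht]; abel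
    have hm := modulus_nonneg (1 / p) s t
    have h1 := modulus_le_rpow hα hs ht
    have h2 := modulus_le_rpow hα h0 hs
    have hx0 := (norm_nonneg _).trans (hx 0 h0 s hs)
    have hX0 := (norm_nonneg _).trans (hX s hs t ht)
    -- The sign of `R` is not assumed; a nonzero modulus forces `R ≥ 0`.
    rcases eq_or_ne (modulus (1 / p) s t) 0 with hz | hz
    · have a1 := hX s hs t ht
      have a2 := hx s hs t ht
      rw [hz, mul_zero] at a2
      rw [hz] at a1 ⊢
      rw [e, norm_le_zero_iff.1 a2, TensorProduct.tmul_zero, add_zero]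
      simpa using a1
    have hR : 0 ≤ R := nonneg_of_mul_nonneg_left ((norm_nonneg _).trans (hx s hs t ht))
      (lt_of_le_of_ne hm hz.symm)
    rw [e]
    calc _ ≤ ‖X s t‖ + ‖incr x 0 s‖ * ‖incr x s t‖ := by
          rw [← TensorProduct.norm_tmul (𝕜 := ℝ)]; exact norm_add_le _ _
      _ ≤ R * modulus (1 / p) s t ^ 2 + (R * T ^ (1 / p)) * (R * modulus (1 / p) s t) := by
          gcongr
          · exact hX s hs t ht
          · exact (hx 0 h0 s hs).trans (by gcongr)
          · exact hx s hs t ht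
      _ = (R * modulus (1 / p) s t + R * T ^ (1 / p) * R) * modulus (1 / p) s t := by ring
      _ ≤ _ := by gcongr
  have htmul : Continuous fun q : E × E => q.1 ⊗ₜ[ℝ] q.2 :=
    ((TensorProduct.mk ℝ E E).mkContinuous₂ 1 fun v w => by
      simp [TensorProduct.norm_tmul]).continuous₂
  have c1 : ContinuousOn (fun q : ℝ × ℝ => X 0 q.2 - X 0 q.1 -
      (incr x 0 q.1) ⊗ₜ[ℝ] (incr x q.1 q.2)) (Icc 0 T ×ˢ Icc 0 T) := by
    have m1 : MapsTo (fun q : ℝ × ℝ => q.1) (Icc 0 T ×ˢ Icc 0 T) (Icc 0 T) := fun q hq => hq.1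
    have m2 : MapsTo (fun q : ℝ × ℝ => q.2) (Icc 0 T ×ˢ Icc 0 T) (Icc 0 T) := fun q hq => hq.2
    have x1 := hxc.comp continuous_fst.continuousOn m1
    have x2 := hxc.comp continuous_snd.continuousOn m2
    exact ((hX0.comp continuous_snd.continuousOn m2).sub
      (hX0.comp continuous_fst.continuousOn m1)).sub
      (htmul.comp_continuousOn ((x1.sub continuousOn_const).prodMk (x2.sub x1)))
  refine c1.congr fun q hq => ?_
  simp only
  rw [← h.chen 0 h0 q.1 hq.1 q.2 hq.2]; abel

variable [FiniteDimensional ℝ E] [FiniteDimensional ℝ W]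

/-- The coefficient of the second-order term as a bounded function with Lipschitz derivative. -/
lemma exists_isBoundedRect_applyTensor {A D : ℝ} {σ : W → E →L[ℝ] W} (hA : IsBoundedRect A σ)
    (hD : IsBoundedRect D (fderiv ℝ σ)) : ∃ (K : ℝ) (G : W → E ⊗[ℝ] E →L[ℝ] W),
      IsBoundedRect K G ∧ ∀ ξ z, G ξ z = applyTensor ((fderiv ℝ σ ξ).comp (σ ξ)) z := by
  obtain ⟨T, hT⟩ := exists_applyTensor_clm (E := E) (W := W)
  have hDA := hD.bilinear (Z := E →L[ℝ] E →L[ℝ] W) hA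
    (ContinuousLinearMap.compL ℝ E W (E →L[ℝ] W))
  exact ⟨_, _, hDA.clm_comp (Z := E →L[ℝ] E →L[ℝ] W) (Z' := E ⊗[ℝ] E →L[ℝ] W) T,
    fun ξ z => hT _ z⟩

/-- A rough path and a vector field of class `C^3_b` give a rough driver, with uniform bounds for
all rough paths of bounded norm. -/
theorem exists_isRoughDriver {p T : ℝ} (hp : 0 < p) (hT : 0 ≤ T) (c : ℝ≥0)
    {σ : W → E →L[ℝ] W} (hσ : IsCkb 3 σ) :
    ∃ C, 0 ≤ C ∧ ∀ (x : ℝ → E) (X : ℝ → ℝ → E ⊗[ℝ] E), IsRoughPath p T x X →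
      roughNorm p T x X ≤ c → IsRoughDriver (1 / p) T C (roughField σ x X) := by
  have hα : 0 < 1 / p := by positivity
  obtain ⟨hd, -, hσ'⟩ := hσ.succ
  obtain ⟨A, hA⟩ := (hσ.mono (by norm_num : 2 ≤ 3)).exists_isBoundedRect
  obtain ⟨D, hD⟩ := hσ'.exists_isBoundedRect
  obtain ⟨K, G, hK, hGv⟩ := exists_isBoundedRect_applyTensor hA hD
  obtain ⟨R, hR⟩ : ∃ R : ℝ, R = c + 2 * c ^ 2 := ⟨_, rfl⟩
  have hR0 : 0 ≤ R := by rw [hR]; positivity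
  obtain ⟨Ω, hΩ⟩ : ∃ Ω, Ω = T ^ (1 / p) := ⟨_, rfl⟩
  have hΩ0 : 0 ≤ Ω := hΩ ▸ Real.rpow_nonneg hT _
  have hA0 := hA.nonneg
  have hD0 := hD.nonneg
  have hK0 := hK.nonneg
  obtain ⟨C, hC⟩ : ∃ C, C = A * R + K * R * Ω := ⟨_, rfl⟩
  have hC0 : 0 ≤ C := by rw [hC]; positivity
  obtain ⟨C', hC'⟩ : ∃ C', C' = 3 * D * C ^ 2 * R + 2 * D * K * R * R + 2 * K * C * R := ⟨_, rfl⟩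
  have hC'0 : 0 ≤ C' := by rw [hC']; positivity
  refine ⟨C + C', by positivity, fun x X hX hn => ?_⟩
  have hV : ∀ s t ξ, roughField σ x X s t ξ = σ ξ (incr x s t) + G ξ (X s t) := fun s t ξ => by
    rw [roughField, hGv]
  have hx : ∀ s ∈ Icc 0 T, ∀ t ∈ Icc 0 T, ‖incr x s t‖ ≤ R * modulus (1 / p) s t :=
    fun s hs t ht => hR ▸ (hX.norm_le hp hn hs ht).1
  have hXX : ∀ s ∈ Icc 0 T, ∀ t ∈ Icc 0 T, ‖X s t‖ ≤ R * modulus (1 / p) s t ^ 2 :=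
    fun s hs t ht => hR ▸ (hX.norm_le hp hn hs ht).2
  -- One estimate for the field and its first and second differences: `d` is `1`, `‖ξ - ζ‖` or `‖a -
  -- c‖ * ‖k‖`.
  have comb : ∀ s ∈ Icc 0 T, ∀ t ∈ Icc 0 T, ∀ (P : E →L[ℝ] W) (Q : E ⊗[ℝ] E →L[ℝ] W) (d : ℝ),
      ‖P‖ ≤ A * d → ‖Q‖ ≤ K * d → 0 ≤ d →
      ‖P (incr x s t) + Q (X s t)‖ ≤ C * modulus (1 / p) s t * d := by
    intro s hs t ht P Q d hP hQ hd0
    have hm := modulus_nonneg (1 / p) s t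
    have hmΩ := modulus_le_rpow hα hs ht
    rw [← hΩ] at hmΩ
    calc _ ≤ ‖P‖ * ‖incr x s t‖ + ‖Q‖ * ‖X s t‖ :=
          (norm_add_le _ _).trans (add_le_add (P.le_opNorm _) (Q.le_opNorm _))
      _ ≤ (A * d) * (R * modulus (1 / p) s t) + (K * d) * (R * modulus (1 / p) s t ^ 2) := by
          gcongr
          · exact hx s hs t ht
          · exact hXX s hs t ht
      _ = (A * R + K * R * modulus (1 / p) s t) * modulus (1 / p) s t * d := by ring
      _ ≤ (A * R + K * R * Ω) * modulus (1 / p) s t * d := by gcongr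
      _ = _ := by rw [hC]
  have norm_le : ∀ s ∈ Icc 0 T, ∀ t ∈ Icc 0 T, ∀ ξ,
      ‖roughField σ x X s t ξ‖ ≤ C * modulus (1 / p) s t := by
    intro s hs t ht ξ
    have := comb s hs t ht (σ ξ) (G ξ) 1 (by simpa using hA.norm_le ξ)
      (by simpa using hK.norm_le ξ) zero_le_one
    rwa [mul_one, ← hV] at this
  have lip : ∀ s ∈ Icc 0 T, ∀ t ∈ Icc 0 T, ∀ ξ ζ,
      ‖roughField σ x X s t ξ - roughField σ x X s t ζ‖ ≤
        C * modulus (1 / p) s t * ‖ξ - ζ‖ := by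
    intro s hs t ht ξ ζ
    have := comb s hs t ht (σ ξ - σ ζ) (G ξ - G ζ) ‖ξ - ζ‖
      (hA.lip ξ ζ) (hK.lip ξ ζ) (norm_nonneg _)
    convert this using 2
    simp only [hV, sub_apply]; abel
  -- The tensor `x_{s,u} ⊗ x_{u,t}` from Chen's relation cancels the leading part of the first-order
  -- Taylor term. What remains has order `2 + 1`, `2 + 1` and `1 + 2` in the modulus.
  have defect : ∀ s ∈ Icc 0 T, ∀ u ∈ Icc 0 T, ∀ t ∈ Icc 0 T, ∀ ξ,
      driverDefect (roughField σ x X) s u t ξ =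
        taylorRemainder σ ξ (roughField σ x X s u ξ) (incr x u t)
        + fderiv ℝ σ ξ (G ξ (X s u)) (incr x u t)
        + (G (ξ + roughField σ x X s u ξ) - G ξ) (X u t) := by
    intro s hs u hu t ht ξ
    have e1 : X s t = X s u + X u t + incr x s u ⊗ₜ[ℝ] incr x u t := by
      rw [← hX.chen s hs u hu t ht]; abel
    have e2 : G ξ (incr x s u ⊗ₜ[ℝ] incr x u t) = fderiv ℝ σ ξ (σ ξ (incr x s u)) (incr x u t) := by
      rw [hGv, applyTensor_tmul]; rfl
    have e3 : incr x s t = incr x s u + incr x u t := by simp [incr]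
    have e4 : fderiv ℝ σ ξ (roughField σ x X s u ξ) (incr x u t) =
        fderiv ℝ σ ξ (σ ξ (incr x s u)) (incr x u t)
        + fderiv ℝ σ ξ (G ξ (X s u)) (incr x u t) := by
      rw [hV, map_add, add_apply]
    rw [driverDefect, taylorRemainder, sub_apply, sub_apply, e4, hV u t, hV s t ξ, e1, e3,
      map_add, map_add, map_add, e2, hV s u ξ, sub_apply]
    abel
  have rK : ∀ s ∈ Icc 0 T, ∀ u ∈ Icc 0 T, ∀ r, modulus (1 / p) s u ≤ r →
      0 ≤ r ∧ ‖incr x s u‖ ≤ R * r ∧ ‖X s u‖ ≤ R * r ^ 2 ∧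
      (∀ ξ, ‖roughField σ x X s u ξ‖ ≤ C * r) ∧
      ∀ ξ ζ, ‖roughField σ x X s u ξ - roughField σ x X s u ζ‖ ≤ C * r * ‖ξ - ζ‖ := by
    intro s hs u hu r hr
    have hm := modulus_nonneg (1 / p) s u
    exact ⟨hm.trans hr, (hx s hs u hu).trans (by gcongr), (hXX s hs u hu).trans (by gcongr),
      fun ξ => (norm_le s hs u hu ξ).trans (by gcongr),
      fun ξ ζ => (lip s hs u hu ξ ζ).trans (by gcongr)⟩
  have hCC : C ≤ C + C' := by linarith
  refine ⟨by positivity, ?_, ?_, ?_, ?_, ?_, ?_⟩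
  · intro s hs t ht ξ
    have hm := modulus_nonneg (1 / p) s t
    exact (norm_le s hs t ht ξ).trans (by gcongr)
  · intro s hs t ht ξ ζ
    have hm := modulus_nonneg (1 / p) s t
    exact (lip s hs t ht ξ ζ).trans (by gcongr)
  · intro s hs t ht a d k
    have hm := modulus_nonneg (1 / p) s t
    have := comb s hs t ht (σ (a + k) - σ a - (σ (d + k) - σ d))
      (G (a + k) - G a - (G (d + k) - G d)) (‖a - d‖ * ‖k‖) (hA.rect a d k) (hK.rect a d k)
      (by positivity)
    refine le_trans (le_of_eq ?_) (this.trans (by gcongr))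
    congr 1
    simp only [hV, sub_apply]; abel
  · intro s hs u hu t ht r hsu hut ξ
    obtain ⟨hr, -, hX1, hw, -⟩ := rK s hs u hu r hsu
    obtain ⟨-, hx2, hX2, -, -⟩ := rK u hu t ht r hut
    set w := roughField σ x X s u ξ with hw_def
    have t1 : ‖taylorRemainder σ ξ w‖ ≤ D * (C * r) ^ 2 :=
      (norm_taylorRemainder_le hd hD ξ w).trans (by gcongr; exact hw ξ)
    have t2 : ‖fderiv ℝ σ ξ (G ξ (X s u))‖ ≤ D * (K * (R * r ^ 2)) := by
      refine (ContinuousLinearMap.le_opNorm _ _).trans ?_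
      gcongr
      · exact hD.norm_le ξ
      · exact (ContinuousLinearMap.le_opNorm _ _).trans (by gcongr; exact hK.norm_le ξ)
    have t3 : ‖G (ξ + w) - G ξ‖ ≤ K * (C * r) := by
      refine (hK.lip _ _).trans ?_
      rw [add_sub_cancel_left]
      gcongr
      exact hw ξ
    rw [defect s hs u hu t ht ξ]
    calc _ ≤ (D * (C * r) ^ 2) * (R * r) + (D * (K * (R * r ^ 2))) * (R * r)
          + (K * (C * r)) * (R * r ^ 2) := by
          refine norm_add₃_le.trans (add_le_add (add_le_add ?_ ?_) ?_) <;>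
            exact (ContinuousLinearMap.le_opNorm _ _).trans (by gcongr)
      _ = (D * C ^ 2 * R + D * K * R * R + K * C * R) * r ^ 3 := by ring
      _ ≤ (C + C') * r ^ 3 := by
          refine mul_le_mul_of_nonneg_right ?_ (by positivity)
          have : 0 ≤ 2 * D * C ^ 2 * R + D * K * R * R + K * C * R := by positivity
          rw [hC']; linarith
  · intro s hs u hu t ht r hsu hut ξ ζ
    obtain ⟨hr, -, hX1, hw, hwd⟩ := rK s hs u hu r hsu
    obtain ⟨-, hx2, hX2, -, -⟩ := rK u hu t ht r hut
    set w := roughField σ x X s u ξ with hw_def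
    set w' := roughField σ x X s u ζ with hw'_def
    have t1 : ‖taylorRemainder σ ξ w - taylorRemainder σ ζ w'‖ ≤ 3 * D * (C * r) ^ 2 * ‖ξ - ζ‖ := by
      have a1 := norm_taylorRemainder_sub_le_left hd hD ξ ζ w
      have a2 := norm_taylorRemainder_sub_le_right hd hD ζ w w'
      calc _ ≤ _ := norm_sub_le_norm_sub_add_norm_sub _ (taylorRemainder σ ζ w) _
        _ ≤ D * ‖w‖ ^ 2 * ‖ξ - ζ‖ + D * (‖w‖ + ‖w'‖) * ‖w - w'‖ := add_le_add a1 a2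
        _ ≤ D * (C * r) ^ 2 * ‖ξ - ζ‖ + D * (C * r + C * r) * (C * r * ‖ξ - ζ‖) := by
            gcongr
            · exact hw ξ
            · exact hw ξ
            · exact hw ζ
            · exact hwd ξ ζ
        _ = _ := by ring
    have t2 : ‖fderiv ℝ σ ξ (G ξ (X s u)) - fderiv ℝ σ ζ (G ζ (X s u))‖ ≤
        2 * (D * K * (R * r ^ 2)) * ‖ξ - ζ‖ := by
      have e : fderiv ℝ σ ξ (G ξ (X s u)) - fderiv ℝ σ ζ (G ζ (X s u)) =
          (fderiv ℝ σ ξ - fderiv ℝ σ ζ) (G ξ (X s u)) + fderiv ℝ σ ζ ((G ξ - G ζ) (X s u)) := by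
        simp only [sub_apply, map_sub]; abel
      have a1 : ‖(fderiv ℝ σ ξ - fderiv ℝ σ ζ) (G ξ (X s u))‖ ≤
          (D * ‖ξ - ζ‖) * (K * (R * r ^ 2)) := by
        refine (ContinuousLinearMap.le_opNorm _ _).trans ?_
        gcongr
        · exact hD.lip ξ ζ
        · exact (ContinuousLinearMap.le_opNorm _ _).trans (by gcongr; exact hK.norm_le ξ)
      have a2 : ‖fderiv ℝ σ ζ ((G ξ - G ζ) (X s u))‖ ≤ D * ((K * ‖ξ - ζ‖) * (R * r ^ 2)) := by
        refine (ContinuousLinearMap.le_opNorm _ _).trans ?_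
        gcongr
        · exact hD.norm_le ζ
        · exact (ContinuousLinearMap.le_opNorm _ _).trans (by gcongr; exact hK.lip ξ ζ)
      rw [e]
      exact (norm_add_le _ _).trans (by linarith)
    have t3 : ‖G (ξ + w) - G ξ - (G (ζ + w') - G ζ)‖ ≤ K * (2 * (C * r)) * ‖ξ - ζ‖ := by
      refine (hK.mixed ξ ζ w w').trans ?_
      calc _ ≤ K * (C * r * ‖ξ - ζ‖ + ‖ξ - ζ‖ * (C * r)) := by
            gcongr
            · exact hwd ξ ζ
            · exact hw ξ
        _ = _ := by ring
    rw [defect s hs u hu t ht ξ, defect s hs u hu t ht ζ]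
    calc _ = ‖(taylorRemainder σ ξ w - taylorRemainder σ ζ w') (incr x u t)
          + (fderiv ℝ σ ξ (G ξ (X s u)) - fderiv ℝ σ ζ (G ζ (X s u))) (incr x u t)
          + (G (ξ + w) - G ξ - (G (ζ + w') - G ζ)) (X u t)‖ := by
          congr 1; simp only [sub_apply]; abel
      _ ≤ (3 * D * (C * r) ^ 2 * ‖ξ - ζ‖) * (R * r)
          + (2 * (D * K * (R * r ^ 2)) * ‖ξ - ζ‖) * (R * r)
          + (K * (2 * (C * r)) * ‖ξ - ζ‖) * (R * r ^ 2) := by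
          refine norm_add₃_le.trans (add_le_add (add_le_add ?_ ?_) ?_) <;>
            exact (ContinuousLinearMap.le_opNorm _ _).trans (by gcongr)
      _ = C' * r ^ 3 * ‖ξ - ζ‖ := by rw [hC']; ring
      _ ≤ _ := by gcongr; linarith
  · intro ξ
    have hxc : ContinuousOn x (Icc 0 T) := continuousOn_of_modulus_bound hα hx
    have c1 : ContinuousOn (fun q : ℝ × ℝ => incr x q.1 q.2) (Icc 0 T ×ˢ Icc 0 T) :=
      (hxc.comp continuous_snd.continuousOn fun q hq => hq.2).sub
        (hxc.comp continuous_fst.continuousOn fun q hq => hq.1)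
    simp only [hV]
    exact ((σ ξ).continuous.comp_continuousOn c1).add
      ((G ξ).continuous.comp_continuousOn (hX.continuousOn_snd hp hx hXX))

end RoughField

/-! ### Davie solutions and solutions in the sense of controlled paths -/

section Equivalence

variable {E : Type*} [NormedAddCommGroup E] [InnerProductSpace ℝ E]
variable {W : Type*} [NormedAddCommGroup W] [NormedSpace ℝ W]

lemma abs_sub_rpow_two_div (p s t : ℝ) : |t - s| ^ (2 / p) = modulus (1 / p) s t ^ 2 := by
  rw [modulus_pow_eq]; congr 1; push_cast; ring

/-- A uniform partition of mesh smaller than `η`. -/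
lemma exists_uniform_partition {a u η : ℝ} (hau : a ≤ u) (hη : 0 < η) :
    ∃ N : ℕ, 0 < N ∧ ∀ i : ℕ,
      (a + ((i + 1 : ℕ) : ℝ) / N * (u - a)) - (a + (i : ℝ) / N * (u - a)) < η := by
  obtain ⟨N, hN⟩ := exists_nat_gt ((u - a) / η)
  have hN0 : (0 : ℝ) < N := lt_of_le_of_lt (div_nonneg (by linarith) hη.le) hN
  refine ⟨N, by exact_mod_cast hN0, fun i => ?_⟩
  have e : (a + ((i + 1 : ℕ) : ℝ) / N * (u - a)) - (a + (i : ℝ) / N * (u - a)) = (u - a) / N := by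
    push_cast; ring
  rw [e, div_lt_iff₀ hN0]
  rw [div_lt_iff₀ hη] at hN
  linarith

lemma uniform_partition_monotone {a u : ℝ} (hau : a ≤ u) (N : ℕ) :
    Monotone fun i : ℕ => a + (i : ℝ) / N * (u - a) := by
  intro i j hij
  have : 0 ≤ u - a := by linarith
  simp only
  gcongr

/-- Rough integrals over adjacent intervals are additive. -/
lemma HasRoughIntegral.sub {x : ℝ → E} {X : ℝ → ℝ → E ⊗[ℝ] E} {Y : ℝ → E →L[ℝ] W}
    {Y' : ℝ → E →L[ℝ] E →L[ℝ] W} {a u v : ℝ} {I J : W} (hau : a ≤ u)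
    (hI : HasRoughIntegral x X Y Y' a u I) (hJ : HasRoughIntegral x X Y Y' a v J) :
    HasRoughIntegral x X Y Y' u v (J - I) := by
  intro ε hε
  obtain ⟨η₁, hη₁, h₁⟩ := hI (ε / 2) (by linarith)
  obtain ⟨η₂, hη₂, h₂⟩ := hJ (ε / 2) (by linarith)
  refine ⟨min η₁ η₂, lt_min hη₁ hη₂, fun n τ hτ hτ0 hτn hmesh => ?_⟩
  obtain ⟨N, hN, hq⟩ := exists_uniform_partition hau (lt_min hη₁ hη₂)
  set q : ℕ → ℝ := fun i => a + (i : ℝ) / N * (u - a) with hq_def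
  have hqm : Monotone q := uniform_partition_monotone hau N
  have hq0 : q 0 = a := by simp [hq_def]
  have hqN : q N = u := by
    have : (N : ℝ) ≠ 0 := by exact_mod_cast hN.ne'
    simp [hq_def, div_self this]
  -- Concatenation of `q` and `τ` without case distinction: truncated subtraction and `τ 0 = u` kill
  -- the second summand up to index `N`, after which the first one stays at `u`.
  set ρ : ℕ → ℝ := fun i => q (min i N) + (τ (i - N) - u) with hρ
  have hρ1 : ∀ i ≤ N, ρ i = q i := fun i hi => by
    simp [hρ, min_eq_left hi, Nat.sub_eq_zero_of_le hi, hτ0]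
  have hρ2 : ∀ i, ρ (N + i) = τ i := fun i => by simp [hρ, hqN]
  have hρm : Monotone ρ := fun i j hij => add_le_add
    (hqm (min_le_min_right N hij)) (sub_le_sub_right (hτ (Nat.sub_le_sub_right hij N)) u)
  set f : (ℕ → ℝ) → ℕ → W := fun τ i => Y (τ i) (incr x (τ i) (τ (i + 1)))
    + applyTensor (Y' (τ i)) (X (τ i) (τ (i + 1))) with hf
  have e1 := h₁ N q hqm hq0 hqN fun i _ => (hq i).trans_le (min_le_left _ _)
  have e2 := h₂ (N + n) ρ hρm (by rw [hρ1 0 (Nat.zero_le _), hq0]) (by rw [hρ2, hτn]) (by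
    intro i hi
    rcases Nat.lt_or_ge i N with h | h
    · rw [hρ1 i h.le, hρ1 (i + 1) h]
      exact (hq i).trans_le (min_le_right _ _)
    · obtain ⟨j, rfl⟩ := Nat.exists_eq_add_of_le h
      rw [add_assoc, hρ2, hρ2]
      exact (hmesh j (by omega)).trans_le (min_le_right _ _))
  change ‖∑ i ∈ Finset.range N, f q i - I‖ < ε / 2 at e1
  change ‖∑ i ∈ Finset.range (N + n), f ρ i - J‖ < ε / 2 at e2
  change ‖∑ i ∈ Finset.range n, f τ i - (J - I)‖ < ε
  have s1 : ∑ i ∈ Finset.range N, f ρ i = ∑ i ∈ Finset.range N, f q i :=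
    Finset.sum_congr rfl fun i hi => by
      have hi := Finset.mem_range.1 hi
      simp only [hf, hρ1 i hi.le, hρ1 (i + 1) hi]
  have s2 : ∑ i ∈ Finset.range n, f ρ (N + i) = ∑ i ∈ Finset.range n, f τ i :=
    Finset.sum_congr rfl fun i hi => by
      simp only [hf, add_assoc, hρ2]
  rw [Finset.sum_range_add, s1, s2] at e2
  calc _ = ‖(∑ i ∈ Finset.range N, f q i + ∑ i ∈ Finset.range n, f τ i - J)
        - (∑ i ∈ Finset.range N, f q i - I)‖ := by congr 1; abel
    _ ≤ _ := norm_sub_le _ _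
    _ < ε := by linarith

/-- A rough integral whose germ is almost additive is close to the germ. -/
lemma HasRoughIntegral.norm_sub_germ_le {x : ℝ → E} {X : ℝ → ℝ → E ⊗[ℝ] E} {Y : ℝ → E →L[ℝ] W}
    {Y' : ℝ → E →L[ℝ] E →L[ℝ] W} {u v : ℝ} {I : W} {Ξ : ℝ → ℝ → W} {α c : ℝ} (hα : 1 / 3 < α)
    (hc : 0 ≤ c) (huv : u ≤ v) (hI : HasRoughIntegral x X Y Y' u v I)
    (hΞ : ∀ s ∈ Icc u v, ∀ t ∈ Icc u v,
      Y s (incr x s t) + applyTensor (Y' s) (X s t) = Ξ s t)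
    (hself : ∀ s ∈ Icc u v, Ξ s s = 0)
    (hadd : ∀ s ∈ Icc u v, ∀ w ∈ Icc u v, ∀ t ∈ Icc u v, s ≤ w → w ≤ t →
      ‖Ξ s t - Ξ s w - Ξ w t‖ ≤ c * modulus α s t ^ 3) :
    ‖I - Ξ u v‖ ≤ c / (1 - (2 / 3 : ℝ) ^ (3 * α - 1)) * modulus α u v ^ 3 := by
  have hκ : (2 / 3 : ℝ) ^ (3 * α - 1) < 1 :=
    Real.rpow_lt_one (by norm_num) (by norm_num) (by linarith)
  refine le_of_forall_pos_le_add fun ε hε => ?_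
  obtain ⟨η, hη, h⟩ := hI ε hε
  obtain ⟨N, hN, hq⟩ := exists_uniform_partition huv hη
  have hN0 : (0 : ℝ) < N := by exact_mod_cast hN
  set q : ℕ → ℝ := fun i => u + (i : ℝ) / N * (v - u) with hq_def
  have hqm : Monotone q := uniform_partition_monotone huv N
  have hq0 : q 0 = u := by simp [hq_def]
  have hqN : q N = v := by simp [hq_def, div_self hN0.ne']
  have hmem : ∀ i ≤ N, q i ∈ Icc u v := fun i hi =>
    ⟨hq0 ▸ hqm (Nat.zero_le i), hqN ▸ hqm hi⟩
  have hI' := h N q hqm hq0 hqN fun i _ => hq i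
  rw [Finset.sum_congr rfl fun i hi => hΞ _ (hmem i (Finset.mem_range.1 hi).le) _
    (hmem (i + 1) (Finset.mem_range.1 hi))] at hI'
  -- The sewn quantity is the Riemann sum between two grid points minus the germ between them; no
  -- Lipschitz factor occurs, so `ρ = 0`.
  have hsew := discrete_sewing (κ := (2 / 3 : ℝ) ^ (3 * α - 1)) (ρ := 0) (c := c)
    (h := (v - u) / N) (n := N)
    (a := fun i k => ‖∑ l ∈ Finset.Ico i k, Ξ (q l) (q (l + 1)) - Ξ (q i) (q k)‖)
    (div_nonneg (by linarith) hN0.le) hα le_rfl hc (by ring) hκ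
    (fun i hi => by simp [hself _ (hmem i hi)]) (fun i _ => by simp) (by
      intro i j k hij hjk hkn
      have e := hadd _ (hmem i (by omega)) _ (hmem j (by omega)) _ (hmem k hkn) (hqm hij) (hqm hjk)
      have hm : modulus α (q i) (q k) ^ 3 = ((k - i : ℕ) * ((v - u) / N)) ^ (3 * α) := by
        rw [modulus_pow_eq, abs_of_nonneg (sub_nonneg.2 (hqm (hij.trans hjk))),
          Nat.cast_sub (hij.trans hjk)]
        push_cast
        congr 1
        simp only [hq_def]; ring
      rw [hm] at e
      have hs := Finset.sum_Ico_consecutive (fun l => Ξ (q l) (q (l + 1))) hij hjk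
      calc _ = ‖(∑ l ∈ Finset.Ico i j, Ξ (q l) (q (l + 1)) - Ξ (q i) (q j))
            + (∑ l ∈ Finset.Ico j k, Ξ (q l) (q (l + 1)) - Ξ (q j) (q k))
            - (Ξ (q i) (q k) - Ξ (q i) (q j) - Ξ (q j) (q k))‖ := by
            rw [← hs]; congr 1; abel
        _ ≤ _ := (norm_sub_le _ _).trans (add_le_add (norm_add_le _ _) e)
        _ = _ := by ring) 0 N (Nat.zero_le _) le_rfl
  simp only [hq0, hqN, Nat.Ico_zero_eq_range, Nat.sub_zero, mul_div_cancel₀ _ hN0.ne'] at hsew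
  have hm : modulus α u v ^ 3 = (v - u) ^ (3 * α) := by
    rw [modulus_pow_eq, abs_of_nonneg (by linarith)]; norm_num
  rw [hm]
  calc ‖I - Ξ u v‖ = ‖(∑ l ∈ Finset.range N, Ξ (q l) (q (l + 1)) - Ξ u v)
        - (∑ l ∈ Finset.range N, Ξ (q l) (q (l + 1)) - I)‖ := by congr 1; abel
    _ ≤ _ := norm_sub_le _ _
    _ ≤ _ := add_le_add hsew hI'.le

variable {p T B C C' A K R : ℝ} {x : ℝ → E} {X : ℝ → ℝ → E ⊗[ℝ] E} {b : W → W}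
  {σ : W → E →L[ℝ] W}

/-- A Davie solution is a solution in the sense of controlled paths. -/
lemma isRDESolution_of_davieBound [CompleteSpace W] (hp : p ∈ Ico (2 : ℝ) 3)
    (hb : IsBoundedLipschitz B b)
    (hfl : IsAlmostFlow (1 / p) T C' (driftFlow b (roughField σ x X)))
    (hσ : ∀ z w, ‖σ z - σ w‖ ≤ A * ‖z - w‖) (hA : 0 ≤ A)
    (hK : ∀ s ∈ Icc 0 T, ∀ t ∈ Icc 0 T, ∀ ξ,
      ‖applyTensor ((fderiv ℝ σ ξ).comp (σ ξ)) (X s t)‖ ≤ K * modulus (1 / p) s t ^ 2)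
    {s : ℝ} (hs : s ∈ Icc 0 T) {y : ℝ → W} {M : ℝ} (hM : 0 ≤ M)
    (hy : DavieBound (1 / p) (driftFlow b (roughField σ x X)) (Icc 0 T) M y) :
    IsRDESolution p T x X b σ s (y s) y (fun t => σ (y t)) := by
  have hp0 : 0 < p := by linarith [hp.1]
  have hα0 : 0 < 1 / p := by positivity
  have hα : 1 / 3 < 1 / p := one_div_lt_one_div_of_lt hp0 hp.2
  have hα' : 1 / p ≤ 1 / 2 := one_div_le_one_div_of_le two_pos hp.1
  have hT : 0 ≤ T := hs.1.trans hs.2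
  have sub : Icc s T ⊆ Icc 0 T := Icc_subset_Icc hs.1 le_rfl
  have hB := hb.nonneg
  have hΘ := Real.rpow_nonneg hT (1 - 2 * (1 / p))
  have hΩ := Real.rpow_nonneg hT (1 / p)
  obtain ⟨H, hH⟩ : ∃ H, H = M * (T ^ (1 / p)) ^ 2 + C' := ⟨_, rfl⟩
  have hH0 : 0 ≤ H := by have := hfl.nonneg; rw [hH]; positivity
  have hyH := hfl.norm_sub_le_of_davieBound hα0 subset_rfl hM hy
  rw [← hH] at hyH
  have hyc := continuousOn_of_modulus_bound hα0 hyH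
  obtain ⟨M₁, hM₁⟩ : ∃ M₁, M₁ = M + B * H * T ^ (1 - 2 * (1 / p)) := ⟨_, rfl⟩
  have hM₁0 : 0 ≤ M₁ := by rw [hM₁]; positivity
  have hstep : ∀ u ∈ Icc 0 T, ∀ v ∈ Icc 0 T,
      ‖stepError b (roughField σ x X) y u v‖ ≤ M₁ * modulus (1 / p) u v ^ 3 := by
    intro u hu v hv
    rw [stepError_eq, hM₁, add_mul]
    exact (norm_sub_le _ _).trans (add_le_add (hy u hu v hv)
      (norm_drift_integral_sub_le_cube hα0 hα' hb le_rfl le_rfl hH0 hyH u hu v hv))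
  refine ⟨⟨holderSeminorm_lt_top (c := A * H) ?_, holderSeminorm_lt_top
    (c := M₁ * T ^ (1 / p) + B * T ^ (1 - 2 * (1 / p)) + K) ?_⟩, ?_⟩
  · intro u hu v hv _
    rw [mul_assoc]
    exact (hσ _ _).trans (by gcongr; exact hyH u (sub hu) v (sub hv))
  · intro u hu v hv _
    have hm := modulus_nonneg (1 / p) u v
    have hmΩ := modulus_le_rpow hα0 (sub hu) (sub hv)
    rw [abs_sub_rpow_two_div]
    have e : incr y u v - σ (y u) (incr x u v) = stepError b (roughField σ x X) y u v
        + (∫ r in u..v, b (y r))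
        + applyTensor ((fderiv ℝ σ (y u)).comp (σ (y u))) (X u v) := by
      rw [stepError, roughField, incr]; abel
    rw [e]
    calc _ ≤ M₁ * modulus (1 / p) u v ^ 3 + B * |v - u| + K * modulus (1 / p) u v ^ 2 :=
          norm_add₃_le.trans (add_le_add (add_le_add (hstep u (sub hu) v (sub hv))
            (IsRoughDriver.norm_drift_integral_le hb y u v)) (hK u (sub hu) v (sub hv) _))
      _ ≤ M₁ * modulus (1 / p) u v ^ 3
          + B * (T ^ (1 - 2 * (1 / p)) * modulus (1 / p) u v ^ 2)
          + K * modulus (1 / p) u v ^ 2 := by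
          gcongr
          exact abs_sub_le_modulus_sq hα' (sub hu) (sub hv)
      _ = (M₁ * modulus (1 / p) u v + B * T ^ (1 - 2 * (1 / p)) + K)
          * modulus (1 / p) u v ^ 2 := by ring
      _ ≤ _ := by gcongr
  · intro t ht ε hε
    obtain ⟨η, hη, hηε⟩ := exists_rpow_small (α := 3 * (1 / p) - 1) (by linarith) (M₁ * T)
      (half_pos hε)
    refine ⟨η, hη, fun n τ hτ hτ0 hτn hmesh => ?_⟩
    have hmem : ∀ i ≤ n, τ i ∈ Icc s T := fun i hi =>
      ⟨hτ0 ▸ hτ (Nat.zero_le i), (hτn ▸ hτ hi).trans ht.2⟩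
    have hs' : s ∈ Icc s T := ⟨le_rfl, hs.2⟩
    -- The candidate for the rough integral. Each compensated summand is an increment of `J` minus a
    -- step error, so the sum telescopes.
    set J : ℝ → W := fun t => y t - y s - ∫ r in s..t, b (y r) with hJ
    have hterm : ∀ i ∈ Finset.range n, σ (y (τ i)) (incr x (τ i) (τ (i + 1)))
        + applyTensor ((fderiv ℝ σ (y (τ i))).comp (σ (y (τ i)))) (X (τ i) (τ (i + 1))) =
        (J (τ (i + 1)) - J (τ i)) - stepError b (roughField σ x X) y (τ i) (τ (i + 1)) := by
      intro i hi
      have hi := Finset.mem_range.1 hi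
      have := intervalIntegral.integral_add_adjacent_intervals
        (hb.intervalIntegrable (hyc.mono sub) hs' (hmem i hi.le))
        (hb.intervalIntegrable (hyc.mono sub) (hmem i hi.le) (hmem (i + 1) hi))
      rw [stepError, roughField, hJ]
      simp only
      rw [← this]
      abel
    have hJ0 : J (τ 0) = 0 := by simp [hJ, hτ0]
    have hJn : J (τ n) = y t - y s - ∫ r in s..t, b (y r) := by rw [hτn]
    rw [Finset.sum_congr rfl hterm, Finset.sum_sub_distrib,
      Finset.sum_range_sub (fun i => J (τ i)) n, hJ0, hJn, sub_zero, sub_sub_cancel_left, norm_neg]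
    -- One power of each step length is kept to sum to `t - s`; the other `3α - 1 > 0` powers are
    -- bounded by the mesh.
    calc _ ≤ ∑ i ∈ Finset.range n,
          M₁ * η ^ (3 * (1 / p) - 1) * (τ (i + 1) - τ i) := by
          refine (norm_sum_le _ _).trans (Finset.sum_le_sum fun i hi => ?_)
          have hi := Finset.mem_range.1 hi
          refine (hstep _ (sub (hmem i hi.le)) _ (sub (hmem (i + 1) hi))).trans ?_
          have h0 : 0 ≤ τ (i + 1) - τ i := sub_nonneg.2 (hτ (Nat.le_succ i))
          rw [modulus_pow_eq, abs_of_nonneg h0, mul_assoc]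
          gcongr
          rcases h0.eq_or_lt with hz | hpos
          · rw [← hz, Real.zero_rpow (by push_cast; positivity), mul_zero]
          · calc (τ (i + 1) - τ i) ^ (((3 : ℕ) : ℝ) * (1 / p))
                = (τ (i + 1) - τ i) ^ (3 * (1 / p) - 1) * (τ (i + 1) - τ i) := by
                  rw [← Real.rpow_add_one hpos.ne']; congr 1; push_cast; ring
              _ ≤ _ := by
                  gcongr
                  · linarith
                  · exact (hmesh i hi).le
      _ = M₁ * η ^ (3 * (1 / p) - 1) * (t - s) := by
          rw [← Finset.mul_sum, Finset.sum_range_sub, hτ0, hτn]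
      _ ≤ M₁ * η ^ (3 * (1 / p) - 1) * T := by
          gcongr
          linarith [ht.2, hs.1]
      _ = M₁ * T * η ^ (3 * (1 / p) - 1) := by ring
      _ < ε := by linarith

/-- At `t = s` the empty partition gives the sum zero, so `y s - ξ` is arbitrarily small. -/
lemma IsRDESolution.apply_initial {s : ℝ} (hs : s ≤ T) {ξ : W} {y : ℝ → W}
    {y' : ℝ → E →L[ℝ] W} (h : IsRDESolution p T x X b σ s ξ y y') : y s = ξ := by
  have h1 := h.equation s ⟨le_rfl, hs⟩
  rw [intervalIntegral.integral_same, sub_zero] at h1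
  refine eq_of_forall_dist_le fun ε hε => ?_
  obtain ⟨η, -, h2⟩ := h1 ε hε
  have := h2 0 (fun _ => s) monotone_const rfl rfl (by simp)
  rw [Finset.sum_range_zero, zero_sub, norm_neg] at this
  rw [dist_eq_norm]; exact this.le

/-- A solution in the sense of controlled paths is a Davie solution. -/
lemma IsRDESolution.exists_davieBound [CompleteSpace W] (hp : p ∈ Ico (2 : ℝ) 3)
    (hb : IsBoundedLipschitz B b) (hV : IsRoughDriver (1 / p) T C (roughField σ x X))
    (hfl : IsAlmostFlow (1 / p) T C' (driftFlow b (roughField σ x X)))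
    (hσ : ∀ z, ‖σ z‖ ≤ A) (hA : 0 ≤ A) (hR : 0 ≤ R) (hK0 : 0 ≤ K)
    (hx : ∀ s ∈ Icc 0 T, ∀ t ∈ Icc 0 T, ‖incr x s t‖ ≤ R * modulus (1 / p) s t)
    (hK : ∀ s ∈ Icc 0 T, ∀ t ∈ Icc 0 T, ∀ ξ,
      ‖applyTensor ((fderiv ℝ σ ξ).comp (σ ξ)) (X s t)‖ ≤ K * modulus (1 / p) s t ^ 2)
    {s : ℝ} (hs : s ∈ Icc 0 T) {ξ : W} {y : ℝ → W} {y' : ℝ → E →L[ℝ] W}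
    (h : IsRDESolution p T x X b σ s ξ y y') (hy' : ∀ t ∈ Icc s T, y' t = σ (y t)) :
    ∃ M, DavieBound (1 / p) (driftFlow b (roughField σ x X)) (Icc s T) M y := by
  have hp0 : 0 < p := by linarith [hp.1]
  have hα0 : 0 < 1 / p := by positivity
  have hα : 1 / 3 < 1 / p := one_div_lt_one_div_of_lt hp0 hp.2
  have hα' : 1 / p ≤ 1 / 2 := one_div_le_one_div_of_le two_pos hp.1
  have hT : 0 ≤ T := hs.1.trans hs.2
  have sub : Icc s T ⊆ Icc 0 T := Icc_subset_Icc hs.1 le_rfl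
  have hB := hb.nonneg
  have hC := hV.nonneg
  have hC' := hfl.nonneg
  have hs' : s ∈ Icc s T := ⟨le_rfl, hs.2⟩
  have hΘ := Real.rpow_nonneg hT (1 - 2 * (1 / p))
  have hΩ := Real.rpow_nonneg hT (1 / p)
  obtain ⟨c, hc0, hc⟩ := exists_norm_le_of_holderSeminorm_lt_top h.controlled.remainder_holder
  have hrem : ∀ u ∈ Icc s T, ∀ v ∈ Icc s T, u ≤ v →
      ‖y v - y u - σ (y u) (incr x u v)‖ ≤ c * modulus (1 / p) u v ^ 2 := by
    intro u hu v hv huv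
    rcases huv.eq_or_lt with rfl | huv
    · simp only [incr, sub_self, map_zero, norm_zero]; positivity
    · have := hc u hu v hv huv
      rwa [abs_sub_rpow_two_div, hy' u hu] at this
  obtain ⟨H, hH⟩ : ∃ H, H = c * T ^ (1 / p) + A * R := ⟨_, rfl⟩
  have hH0 : 0 ≤ H := by rw [hH]; positivity
  have hyH_le : ∀ u ∈ Icc s T, ∀ v ∈ Icc s T, u ≤ v →
      ‖y v - y u‖ ≤ H * modulus (1 / p) u v := by
    intro u hu v hv huv
    have hm := modulus_nonneg (1 / p) u v
    have hmΩ := modulus_le_rpow hα0 (sub hu) (sub hv)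
    calc ‖y v - y u‖ = ‖(y v - y u - σ (y u) (incr x u v)) + σ (y u) (incr x u v)‖ := by
          congr 1; abel
      _ ≤ c * modulus (1 / p) u v ^ 2 + A * (R * modulus (1 / p) u v) := by
          refine (norm_add_le _ _).trans (add_le_add (hrem u hu v hv huv) ?_)
          refine (ContinuousLinearMap.le_opNorm _ _).trans ?_
          gcongr
          · exact hσ _
          · exact hx u (sub hu) v (sub hv)
      _ = (c * modulus (1 / p) u v + A * R) * modulus (1 / p) u v := by ring
      _ ≤ (c * T ^ (1 / p) + A * R) * modulus (1 / p) u v := by gcongr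
      _ = _ := by rw [hH]
  have hyH : ∀ u ∈ Icc s T, ∀ v ∈ Icc s T, ‖y v - y u‖ ≤ H * modulus (1 / p) u v := by
    intro u hu v hv
    rcases le_total u v with huv | huv
    · exact hyH_le u hu v hv huv
    · rw [norm_sub_rev, modulus_comm]; exact hyH_le v hv u hu huv
  have hyc := continuousOn_of_modulus_bound hα0 hyH
  obtain ⟨Q, hQ⟩ : ∃ Q, Q = C * (c + K) + C := ⟨_, rfl⟩
  have hQ0 : 0 ≤ Q := by rw [hQ]; positivity
  -- The failure of additivity is the driver defect plus the change of `V w v` between `y w` and the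
  -- driver step from `y u`. These two points are at distance of order `2α` by the controlled
  -- remainder, and `V w v` has Lipschitz constant of order `α`.
  have hgerm : ∀ u ∈ Icc s T, ∀ w ∈ Icc s T, ∀ v ∈ Icc s T, u ≤ w → w ≤ v →
      ‖roughField σ x X u v (y u) - roughField σ x X u w (y u) - roughField σ x X w v (y w)‖ ≤
        Q * modulus (1 / p) u v ^ 3 := by
    intro u hu w hw v hv huw hwv
    have hm := modulus_nonneg (1 / p) u v
    have m1 : modulus (1 / p) u w ≤ modulus (1 / p) u v := modulus_mono hα0 (by
      rw [abs_of_nonneg (by linarith), abs_of_nonneg (by linarith)]; linarith)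
    have m2 : modulus (1 / p) w v ≤ modulus (1 / p) u v := modulus_mono hα0 (by
      rw [abs_of_nonneg (by linarith), abs_of_nonneg (by linarith)]; linarith)
    have hm1 := modulus_nonneg (1 / p) u w
    have he : ‖y w - (y u + roughField σ x X u w (y u))‖ ≤ (c + K) * modulus (1 / p) u v ^ 2 := by
      have e : y w - (y u + roughField σ x X u w (y u)) =
          (y w - y u - σ (y u) (incr x u w))
          - applyTensor ((fderiv ℝ σ (y u)).comp (σ (y u))) (X u w) := by
        rw [roughField]; abel
      rw [e]
      calc _ ≤ c * modulus (1 / p) u w ^ 2 + K * modulus (1 / p) u w ^ 2 :=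
            (norm_sub_le _ _).trans (add_le_add (hrem u hu w hw huw) (hK u (sub hu) w (sub hw) _))
        _ = (c + K) * modulus (1 / p) u w ^ 2 := by ring
        _ ≤ _ := by gcongr
    have h1 := hV.lip w (sub hw) v (sub hv) (y w) (y u + roughField σ x X u w (y u))
    have h2 := hV.defect_le u (sub hu) w (sub hw) v (sub hv) _ m1 m2 (y u)
    calc _ = ‖(roughField σ x X w v (y w)
          - roughField σ x X w v (y u + roughField σ x X u w (y u)))
          + driverDefect (roughField σ x X) u w v (y u)‖ := by
          rw [← norm_neg, driverDefect]; congr 1; abel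
      _ ≤ C * modulus (1 / p) u v * ((c + K) * modulus (1 / p) u v ^ 2)
          + C * modulus (1 / p) u v ^ 3 :=
          (norm_add_le _ _).trans (add_le_add (h1.trans (by gcongr)) h2)
      _ = _ := by rw [hQ]; ring
  have hκ : (2 / 3 : ℝ) ^ (3 * (1 / p) - 1) < 1 :=
    Real.rpow_lt_one (by norm_num) (by norm_num) (by linarith)
  obtain ⟨M, hM⟩ : ∃ M, M = Q / (1 - (2 / 3 : ℝ) ^ (3 * (1 / p) - 1))
    + B * H * T ^ (1 - 2 * (1 / p)) := ⟨_, rfl⟩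
  have hfwd : ∀ u ∈ Icc s T, ∀ v ∈ Icc s T, u ≤ v →
      ‖y v - driftFlow b (roughField σ x X) u v (y u)‖ ≤ M * modulus (1 / p) u v ^ 3 := by
    intro u hu v hv huv
    have huvs : Icc u v ⊆ Icc s T := Icc_subset_Icc hu.1 hv.2
    have hint := (h.equation u hu).sub hu.1 (h.equation v hv)
    have e1 := hint.norm_sub_germ_le (Ξ := fun r q => roughField σ x X r q (y r)) hα hQ0 huv
      (fun r hr q hq => by rw [roughField, hy' r (huvs hr)])
      (fun r hr => by
        have := hV.norm_le r (sub (huvs hr)) r (sub (huvs hr)) (y r)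
        rw [modulus_self hα0, mul_zero] at this
        exact norm_le_zero_iff.1 this)
      (fun r hr w hw q hq => hgerm r (huvs hr) w (huvs hw) q (huvs hq))
    have e2 := norm_drift_integral_sub_le_cube hα0 hα' hb hs.1 le_rfl hH0 hyH u hu v hv
    have e3 := intervalIntegral.integral_add_adjacent_intervals
      (hb.intervalIntegrable hyc hs' hu) (hb.intervalIntegrable hyc hu hv)
    rw [← e3] at e1
    rw [hM, add_mul]
    refine le_trans (le_of_eq ?_) ((norm_add_le _ _).trans (add_le_add e1 e2))
    congr 1
    rw [driftFlow]; abel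
  refine ⟨max M (C' + (1 + C' * T ^ (1 / p)) * M), fun u hu v hv => ?_⟩
  have hm := pow_nonneg (modulus_nonneg (1 / p) u v) 3
  rcases le_total u v with huv | huv
  · exact (hfwd u hu v hv huv).trans (by gcongr; exact le_max_left _ _)
  · refine (hfl.reverse hα0 (sub hv) (sub hu) (hfwd v hv u hu huv)).trans ?_
    gcongr; exact le_max_right _ _

end Equivalence

end RoughPaths

/-! ### The theorem from the Davie flow and the equivalence of solutions -/

theorem proposition4 (d m : ℕ) (p T : ℝ) (hp : p ∈ Set.Ico (2 : ℝ) 3) (hT : 0 < T) (C₀ : ℝ≥0)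
    (b : EuclideanSpace ℝ (Fin d) → EuclideanSpace ℝ (Fin d))
    (hb_bdd : ∃ B : ℝ, ∀ z, ‖b z‖ ≤ B) (hb_lip : ∃ K : ℝ≥0, LipschitzWith K b)
    (σ : EuclideanSpace ℝ (Fin d) → EuclideanSpace ℝ (Fin m) →L[ℝ] EuclideanSpace ℝ (Fin d))
    (hσ : RoughPaths.IsCkb 3 σ) :
    ∃ δ L : ℝ, 0 < δ ∧ 0 < L ∧
      ∀ (x : ℝ → EuclideanSpace ℝ (Fin m))
        (X : ℝ → ℝ → EuclideanSpace ℝ (Fin m) ⊗[ℝ] EuclideanSpace ℝ (Fin m)),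
        RoughPaths.IsRoughPath p T x X → RoughPaths.roughNorm p T x X ≤ C₀ →
        -- existence and uniqueness for every starting time and every initial value
        (∀ s ∈ Set.Icc 0 T, ∀ ξ : EuclideanSpace ℝ (Fin d),
          (∃ y y', RoughPaths.IsRDESolution p T x X b σ s ξ y y' ∧
            ∀ t ∈ Set.Icc s T, y' t = σ (y t)) ∧
          ∀ y y' z z',
            RoughPaths.IsRDESolution p T x X b σ s ξ y y' → (∀ t ∈ Set.Icc s T, y' t = σ (y t)) →
            RoughPaths.IsRDESolution p T x X b σ s ξ z z' → (∀ t ∈ Set.Icc s T, z' t = σ (z t)) →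
            Set.EqOn y z (Set.Icc s T) ∧ Set.EqOn y' z' (Set.Icc s T)) ∧
        -- the solutions form a continuous flow with the local Lipschitz estimate
        ∃ φ : ℝ → ℝ → EuclideanSpace ℝ (Fin d) → EuclideanSpace ℝ (Fin d),
          RoughPaths.IsContinuousFlow (Set.Icc 0 T) φ ∧
          (∀ s ∈ Set.Icc 0 T, ∀ ζ, RoughPaths.IsRDESolution p T x X b σ s ζ
            (fun t => φ s t ζ) (fun t => σ (φ s t ζ))) ∧
          ∀ s ∈ Set.Icc 0 T, ∀ t ∈ Set.Icc 0 T, s < t → |t - s| ≤ δ → ∀ ζ₁ ζ₂,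
            ‖φ s t ζ₁ - φ s t ζ₂‖ ≤ (1 + L * |t - s| ^ (1 / p)) * ‖ζ₁ - ζ₂‖ := by
  obtain ⟨B₀, hB₀⟩ := hb_bdd
  obtain ⟨B₁, hB₁⟩ := hb_lip
  have hB₀0 : 0 ≤ B₀ := (norm_nonneg _).trans (hB₀ 0)
  have hb : RoughPaths.IsBoundedLipschitz (B₀ + B₁) b :=
    ⟨by positivity, fun z => (hB₀ z).trans (by simp), fun z w =>
      (hB₁.norm_sub_le z w).trans (by gcongr; simpa using hB₀0)⟩
  have hp0 : 0 < p := by linarith [hp.1]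
  have hα : 1 / 3 < 1 / p := one_div_lt_one_div_of_lt hp0 hp.2
  have hα' : 1 / p ≤ 1 / 2 := one_div_le_one_div_of_le two_pos hp.1
  obtain ⟨A, hA⟩ := (hσ.mono (by norm_num : 2 ≤ 3)).exists_isBoundedRect
  obtain ⟨D, hD⟩ := hσ.succ.2.2.exists_isBoundedRect
  obtain ⟨K, G, hK, hG⟩ := RoughPaths.exists_isBoundedRect_applyTensor hA hD
  have hK0 := hK.nonneg
  obtain ⟨C, hC0, hC⟩ := RoughPaths.exists_isRoughDriver hp0 hT.le C₀ hσ
  obtain ⟨C', hC'⟩ := RoughPaths.IsRoughDriver.exists_isAlmostFlow hα hα' hT.le hb C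
  obtain ⟨δ, L, hδ, hL, hflow⟩ := RoughPaths.exists_davie_flow hα hα' hT.le hb hC0
  -- All constants are fixed before the rough path enters.
  refine ⟨δ, L, hδ, hL, fun x X hX hn => ?_⟩
  have hV := hC x X hX hn
  have hfl := hC' _ hV
  obtain ⟨huniq, φ, hφ, hφD, hφL⟩ := hflow _ hV
  have hR : (0 : ℝ) ≤ C₀ + 2 * C₀ ^ 2 := by positivity
  have hKX : ∀ s ∈ Icc 0 T, ∀ t ∈ Icc 0 T, ∀ ξ,
      ‖RoughPaths.applyTensor ((fderiv ℝ σ ξ).comp (σ ξ)) (X s t)‖ ≤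
        K * (C₀ + 2 * C₀ ^ 2) * RoughPaths.modulus (1 / p) s t ^ 2 := by
    intro s hs t ht ξ
    rw [mul_assoc, ← hG]
    exact (ContinuousLinearMap.le_opNorm _ _).trans
      (mul_le_mul (hK.norm_le ξ) (hX.norm_le hp0 hn hs ht).2 (norm_nonneg _) hK0)
  have hsol : ∀ s ∈ Icc 0 T, ∀ ζ, RoughPaths.IsRDESolution p T x X b σ s ζ
      (fun t => φ s t ζ) (fun t => σ (φ s t ζ)) := by
    intro s hs ζ
    obtain ⟨M, hM0, hM⟩ := hφD s hs ζ
    have := RoughPaths.isRDESolution_of_davieBound hp hb hfl hA.lip hA.nonneg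
      hKX hs hM0 hM
    rwa [hφ.refl s hs ζ] at this
  refine ⟨fun s hs ξ => ⟨⟨_, _, hsol s hs ξ, fun t _ => rfl⟩, ?_⟩, φ, hφ, hsol, ?_⟩
  · intro y y' z z' hy hy' hz hz'
    -- Uniqueness is that of Davie solutions on `[s, T]` agreeing at `s`; the derivatives then agree
    -- because both are `σ` of the path.
    have dav := fun (y : ℝ → EuclideanSpace ℝ (Fin d)) y'
        (hy : RoughPaths.IsRDESolution p T x X b σ s ξ y y') hy' =>
      hy.exists_davieBound hp hb hV hfl hA.norm_le hA.nonneg hR (by positivity)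
        (fun s hs t ht => (hX.norm_le hp0 hn hs ht).1) hKX hs hy'
    have heq := huniq s T hs.1 le_rfl y z (dav y y' hy hy') (dav z z' hz hz') s ⟨le_rfl, hs.2⟩
      ((hy.apply_initial hs.2).trans (hz.apply_initial hs.2).symm)
    exact ⟨heq, fun t ht => by rw [hy' t ht, hz' t ht, heq ht]⟩
  · intro s hs t ht _ hst ζ₁ ζ₂
    exact hφL s hs t ht hst ζ₁ ζ₂
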